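/- Write $I=[0,1]$. A function $v:I\to\mathbb C$ is a \emph{generalized polynomial} if $v(x)=C\prod_{j=0}^{l}\bigl(\sigma_j(x-c_j)\bigr)^{s_j}$ for all $x\in I$, with a constant $C\neq 0$, an integer $l\ge 0$, points $c_j\in I$, exponents $s_j>0$, and each $\sigma_j$ equal to $\sigma_j(u)=u$ or $\sigma_j(u)=|u|$, where every real power that occurs is required to be defined on all of $I$ (a power of a negative number is defined only for rational exponents with odd denominator). For a sequence $\omega=(x_n)_{n\ge1}$ put $$D_N(\omega)=\sup_{0\le a<b\le 1}\left|\frac{\#\{1\le n\le N: x_n\in[a,b)\}}{N}-(b-a)\right|,$$ and for a map $\tau:I\to I$ let $D_N(\tau)=\sup_{x\in[0,1)}D_N\bigl((\tau^n(x))_{n\ge1}\bigr)$. A nontrivial hyperinvariant subspace of a bounded operator $T$ is a closed subspace, different from $\{0\}$ and from the whole space, that is invariant under every bounded operator commuting with $T$. Let $d\ge1$, $1\le p\le\infty$, $\varepsilon>0$, let $v_1,\dots,v_d$ be generalized polynomials, and put $v(x)=\prod_{i=1}^d v_i(x_i)$ for $x\in[0,1]^d$. All $L^p$ spaces are complex and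 taken with respect to Lebesgue measure. (1) Let $\tau_1,\dots,\tau_d:I\to I$ be such that $\tau(x)=(\tau_1(x_1),\dots,\tau_d(x_d))$ is a bijective (measure-preserving) ergodic transformation of $[0,1]^d$ and $$\sup_{1\le i\le d}D_n(\tau_i)=O\!\left(\frac{1}{\ln^{3+\varepsilon}n}\right)\qquad(n\to\infty).$$ Then $Tf=v\cdot(f\circ\tau)$ is a well-defined bounded operator on $L^p([0,1]^d)$, and $T$ has a nontrivial hyperinvariant subspace. (2) The same conclusion holds for the rotation $\tau(x)=(\{x_1+\alpha_1\},\dots,\{x_d+\alpha_d\})$, where $\{\cdot\}$ denotes the fractional part, whenever $\alpha\in\mathbb R^d$ is such that $1,\alpha_1,\dots,\alpha_d$ are linearly independent over $\mathbb Q$ and the coordinate rotations $\tau_i(t)=\{t+\alpha_i\}$ satisfy the discrepancy condition in (1). -/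

import Mathlib

open scoped unitInterval ENNReal

noncomputable section

namespace WeightedComposition

/-- `y` is the real power `t ^ s`. For `t < 0` this power is defined only when `s = a / b` with
natural numbers `a`, `b` and `b` odd, and then it is the real `b`-th root of `t ^ a`. -/
def IsRealPower (t s y : ℝ) : Prop :=
  (0 ≤ t ∧ y = t ^ s) ∨ (t < 0 ∧ ∃ a b : ℕ, Odd b ∧ s = (a : ℝ) / b ∧ y ^ b = t ^ a)

/-- Generalized polynomials on `[0,1]`: `v x = C * ∏ j, (h j (x - c j)) ^ (s j)` with `C ≠ 0`,
at least one factor, points `c j` in `[0,1]`, exponents `s j > 0`, and each `h j` either the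
identity or the absolute value. The function `g j` is the `j`-th factor; in particular each
power that occurs has to be defined on all of `[0,1]`. -/
def IsGeneralizedPolynomial (v : I → ℂ) : Prop :=
  ∃ (l : ℕ) (C : ℂ) (c : Fin (l + 1) → I) (s : Fin (l + 1) → ℝ)
    (h : Fin (l + 1) → ℝ → ℝ) (g : Fin (l + 1) → I → ℝ),
    C ≠ 0 ∧ (∀ j, 0 < s j) ∧
    (∀ j, (∀ u, h j u = u) ∨ (∀ u, h j u = |u|)) ∧
    (∀ j (x : I), IsRealPower (h j ((x : ℝ) - (c j : ℝ))) (s j) (g j x)) ∧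
    ∀ x : I, v x = C * ∏ j, (g j x : ℂ)

/-- The number of indices `1 ≤ n ≤ N` with `ω n ∈ E`. -/
def visitCount (N : ℕ) (E : Set ℝ) (ω : ℕ → ℝ) : ℕ :=
  Set.ncard {n : ℕ | 1 ≤ n ∧ n ≤ N ∧ ω n ∈ E}

/-- The discrepancy of the first `N` terms `ω 1, …, ω N` of a sequence. -/
def discrepancy (N : ℕ) (ω : ℕ → ℝ) : ℝ :=
  sSup {r : ℝ | ∃ a b : ℝ, 0 ≤ a ∧ a < b ∧ b ≤ 1 ∧
    r = |(visitCount N (Set.Ico a b) ω : ℝ) / N - (b - a)|}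

/-- The discrepancy of a map `τ` of `[0,1]`: the supremum over the starting points `x ∈ [0,1)`
of the discrepancy of the orbit `(τ^n x)_{n ≥ 1}`. -/
def mapDiscrepancy (τ : I → I) (N : ℕ) : ℝ :=
  sSup {r : ℝ | ∃ x : I, (x : ℝ) < 1 ∧ r = discrepancy N (fun n => ((τ^[n] x : I) : ℝ))}

/-- The map `(x_1, …, x_d) ↦ (τ_1 x_1, …, τ_d x_d)` of `[0,1]^d`. -/
def productMap {d : ℕ} (τ : Fin d → I → I) (x : Fin d → I) : Fin d → I :=
  fun i => τ i (x i)

/-- The weight `v(x) = v_1(x_1) ⋯ v_d(x_d)` on `[0,1]^d`. -/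
def productWeight {d : ℕ} (v : Fin d → I → ℂ) (x : Fin d → I) : ℂ :=
  ∏ i, v i (x i)

/-- The complex space `L^p([0,1]^d)` with respect to Lebesgue measure. -/
abbrev LpCube (d : ℕ) (p : ℝ≥0∞) : Type :=
  MeasureTheory.Lp ℂ p (MeasureTheory.volume : MeasureTheory.Measure (Fin d → I))

/-- `T` is the weighted composition operator `T f = v · (f ∘ τ)`. -/
def IsWeightedCompositionOperator {d : ℕ} {p : ℝ≥0∞} [Fact (1 ≤ p)]
    (v : (Fin d → I) → ℂ) (τ : (Fin d → I) → (Fin d → I))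
    (T : LpCube d p →L[ℂ] LpCube d p) : Prop :=
  ∀ f : LpCube d p,
    (fun x => (T f : (Fin d → I) → ℂ) x) =ᵐ[MeasureTheory.volume]
      fun x => v x * (f : (Fin d → I) → ℂ) (τ x)

/-- `T` has a nontrivial hyperinvariant subspace: a closed subspace, different from `0` and from
the whole space, that is invariant under every bounded operator commuting with `T`. -/
def HasNontrivialHyperinvariantSubspace {E : Type*} [NormedAddCommGroup E] [NormedSpace ℂ E]
    (T : E →L[ℂ] E) : Prop :=
  ∃ M : Submodule ℂ E, IsClosed (M : Set E) ∧ M ≠ ⊥ ∧ M ≠ ⊤ ∧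
    ∀ S : E →L[ℂ] E, S.comp T = T.comp S → ∀ f ∈ M, S f ∈ M

/-- The rotation `x ↦ {x + α}` on `[0,1]`, where `{·}` is the fractional part. -/
def rotation (α : ℝ) (x : I) : I :=
  ⟨Int.fract ((x : ℝ) + α), Int.fract_nonneg _, (Int.fract_lt_one _).le⟩

/-- The vector `α` is irrational: `1, α_1, …, α_d` are linearly independent over `ℚ`. -/
def IsIrrationalVector {d : ℕ} (α : Fin d → ℝ) : Prop :=
  LinearIndependent ℚ (Fin.cons (1 : ℝ) α : Fin (d + 1) → ℝ)

/-- `sup_i D_{i,n} = O(1 / ln^{3+ε} n)`, with `D_{i,n}` the discrepancy of `τ i`. -/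
def DiscrepancyCondition {d : ℕ} (τ : Fin d → I → I) (ε : ℝ) : Prop :=
  (fun n : ℕ => ⨆ i, mapDiscrepancy (τ i) n) =O[Filter.atTop]
    fun n : ℕ => 1 / Real.log (n : ℝ) ^ (3 + ε)

end WeightedComposition

end

/-! Let U be the weighted composition operator whose weight is v divided by its geometric mean,
changed on the zero set of v. Almost everywhere T is a nonzero multiple of U. On the space of all
functions U is invertible, so its orbits are two-sided even when T is not invertible.

Suppose ξ_n = U^n g and η_n = (U^t)^n g', n ∈ ℤ, lie in L^p and L^q with norms O(R(|n|)), where ∑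
log R(n)/n² converges in dyadic form. Such growth is non-quasianalytic: averaging a tent function
over intervals of summable total length gives Fourier coefficients a, b of two functions with
disjoint supports, absolutely summable against R, so a * b = 0 (`exists_convolution_eq_zero`). Put X
= ∑ a_n ξ_n and Y = ∑ b_n η_n. If S commutes with T, then ⟨Sξ_n, η_m⟩ depends only on n + m, hence
⟨SX, Y⟩ = ∑_k (a * b)(k) ⟨Sξ_0, η_k⟩ = 0. The vectors h with ⟨Sh, Y⟩ = 0 for all such S form a
closed hyperinvariant subspace; it contains X ≠ 0 and is proper as Y ≠ 0
(`hasNontrivialHyperinvariantSubspace_of_growth`). Freeness of almost every orbit allows g, g' to be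
localized so that X, Y ≠ 0.

The growth bound comes from discrepancy. The logarithm of a product of n weights along an orbit is a
combination of deviations of sums of log|t - c| from n times the integral. A Koksma inequality for
the logarithm truncated at distance δ/(n+1)² bounds these by O(n D_n log n + 1). Truncation is
harmless for upper bounds; for inverse powers, g and g' are supported on a set of positive measure
whose orbits keep distance δ/(|k|+1)² from the zeros at time k. Vanishing discrepancy also rules out
periodic orbits. -/

open MeasureTheory Filter Topology

/-! ### Absolutely convergent Fourier series supported near an integer -/

/-- The character `x ↦ exp (2 π i n x)` of the real line. -/
noncomputable def trigChar (n : ℤ) (x : ℝ) : ℂ := Complex.exp (((2 * Real.pi * n * x : ℝ) : ℂ) * Complex.I)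

lemma norm_trigChar (n : ℤ) (x : ℝ) : ‖trigChar n x‖ = 1 := Complex.norm_exp_ofReal_mul_I _

lemma trigChar_add (n : ℤ) (x y : ℝ) : trigChar n (x + y) = trigChar n x * trigChar n y := by
  rw [trigChar, trigChar, trigChar, ← Complex.exp_add]; push_cast; ring_nf

lemma trigChar_add_left (n m : ℤ) (x : ℝ) :
    trigChar (n + m) x = trigChar n x * trigChar m x := by
  rw [trigChar, trigChar, trigChar, ← Complex.exp_add]; push_cast; ring_nf

lemma trigChar_zero (x : ℝ) : trigChar 0 x = 1 := by simp [trigChar]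

lemma trigChar_int (n k : ℤ) : trigChar n k = 1 := by
  rw [trigChar, Complex.exp_eq_one_iff]
  exact ⟨n * k, by push_cast; ring⟩

@[fun_prop]
lemma continuous_trigChar (n : ℤ) : Continuous (trigChar n) := by
  unfold trigChar; fun_prop

/-- Averaging over `[-e, e]` is the Fourier multiplier `sinc (2πne)`; this is how decay of
coefficients is produced. -/
lemma integral_trigChar_symm (n : ℤ) (e : ℝ) :
    ∫ t in -e..e, trigChar n t = ((2 * e * Real.sinc (2 * Real.pi * n * e) : ℝ) : ℂ) := by
  by_cases hn : n = 0
  · subst hn; simp [trigChar]; ring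
  have hc : 2 * Real.pi * n ≠ 0 := by
    have : (n : ℝ) ≠ 0 := by exact_mod_cast hn
    positivity
  have h := intervalIntegral.integral_comp_mul_left (a := -e) (b := e)
    (fun t : ℝ => Complex.exp ((t : ℂ) * Complex.I)) hc
  have h2 := integral_exp_mul_I_eq_sinc (2 * Real.pi * n * e)
  simp only [trigChar]
  rw [h, mul_neg, h2, Complex.real_smul]
  have hc' : ((2 * Real.pi * n : ℝ) : ℂ) ≠ 0 := by exact_mod_cast hc
  push_cast at hc' ⊢
  field_simp

lemma integral_trigChar (n : ℤ) : ∫ t in (0 : ℝ)..1, trigChar n t = if n = 0 then 1 else 0 := by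
  split_ifs with hn
  · subst hn; simp [trigChar]
  have hn' : (n : ℂ) ≠ 0 := by exact_mod_cast hn
  have hc : (2 * Real.pi * n * Complex.I : ℂ) ≠ 0 := by simp [hn', Real.pi_ne_zero]
  have h := integral_exp_mul_complex (a := 0) (b := 1) hc
  have h1 : trigChar n 1 = 1 := by exact_mod_cast trigChar_int n 1
  have : ∀ t : ℝ, trigChar n t = Complex.exp (2 * Real.pi * n * Complex.I * t) := by
    intro t; unfold trigChar; congr 1; push_cast; ring
  rw [this] at h1
  simp only [this]
  rw [h, h1]
  simp

/-- The index type is arbitrary so that both single series and the double series of a product are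
covered. -/
lemma hasSum_integral_trigChar {ι : Type*} [Countable ι] (c : ι → ℂ) (k : ι → ℤ)
    (hc : Summable fun i => ‖c i‖) (p q : ℝ) :
    HasSum (fun i => c i * ∫ x in p..q, trigChar (k i) x)
      (∫ x in p..q, ∑' i, c i * trigChar (k i) x) := by
  have hb : ∀ (x : ℝ) (i : ι), ‖c i * trigChar (k i) x‖ = ‖c i‖ := by
    intro x i; rw [norm_mul, norm_trigChar, mul_one]
  have := intervalIntegral.hasSum_integral_of_dominated_convergence (μ := MeasureTheory.volume)
    (a := p) (b := q) (F := fun i x => c i * trigChar (k i) x)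
    (f := fun x => ∑' i, c i * trigChar (k i) x) (fun i _ => ‖c i‖)
    (fun i => by fun_prop) (fun i => .of_forall fun t _ => (hb t i).le)
    (.of_forall fun t _ => hc) intervalIntegrable_const
    (.of_forall fun t _ => (Summable.of_norm (by simpa only [hb] using hc)).hasSum)
  simpa only [intervalIntegral.integral_const_mul] using this

/-- The trigonometric series with coefficients `a`. -/
noncomputable def trigSeries (a : ℤ → ℂ) (x : ℝ) : ℂ := ∑' n, a n * trigChar n x

lemma norm_mul_trigChar (z : ℂ) (n : ℤ) (x : ℝ) : ‖z * trigChar n x‖ = ‖z‖ := by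
  rw [norm_mul, norm_trigChar, mul_one]

lemma trigSeries_add_int (a : ℤ → ℂ) (x : ℝ) (k : ℤ) :
    trigSeries a (x + k) = trigSeries a x := by
  simp only [trigSeries, trigChar_add, trigChar_int, mul_one]

/-- The series with coefficients `a` converges absolutely and its sum vanishes outside the
`r`-neighbourhood of the integers. -/
structure SupportedNear (r : ℝ) (a : ℤ → ℂ) : Prop where
  summable : Summable fun n => ‖a n‖
  eq_zero : ∀ x, r ≤ x → x ≤ 1 - r → trigSeries a x = 0

/-- The new series is the mean of the old one over `[x - e, x + e]`, so the support grows by at most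
`e` on each side. -/
lemma SupportedNear.mul_sinc {r : ℝ} {a : ℤ → ℂ} (h : SupportedNear r a) {e : ℝ} (he : 0 < e) :
    SupportedNear (r + e) fun n => a n * (Real.sinc (2 * Real.pi * n * e) : ℂ) := by
  constructor
  · refine Summable.of_nonneg_of_le (fun _ => norm_nonneg _) (fun n => ?_) h.summable
    rw [norm_mul, Complex.norm_real]
    exact mul_le_of_le_one_right (norm_nonneg _) (Real.abs_sinc_le_one _)
  intro x hx1 hx2
  have h1 := (hasSum_integral_trigChar (fun n : ℤ => a n * trigChar n x) id
    (by simpa only [norm_mul_trigChar] using h.summable) (-e) e).tsum_eq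
  have h2 : ∫ t in -e..e, ∑' n : ℤ, a n * trigChar n x * trigChar (id n) t = 0 := by
    rw [intervalIntegral.integral_congr (g := fun _ => 0)]
    · simp
    · intro t ht
      rw [Set.uIcc_of_le (by linarith)] at ht
      have := h.eq_zero (x + t) (by linarith [ht.1]) (by linarith [ht.2])
      simpa only [trigSeries, trigChar_add, id, mul_assoc] using this
  rw [h2] at h1
  have h3 : ((2 * e : ℝ) : ℂ) * trigSeries
      (fun n => a n * (Real.sinc (2 * Real.pi * n * e) : ℂ)) x = 0 := by
    rw [← h1, trigSeries, ← tsum_mul_left]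
    refine tsum_congr fun n => ?_
    rw [id, integral_trigChar_symm]
    push_cast; ring
  have he' : ((2 * e : ℝ) : ℂ) ≠ 0 := by exact_mod_cast (by positivity : 2 * e ≠ 0)
  exact (mul_eq_zero.mp h3).resolve_left he'

lemma SupportedNear.mul_sinc_pow {r : ℝ} {a : ℤ → ℂ} (h : SupportedNear r a) {e : ℝ} (he : 0 < e)
    (N : ℕ) :
    SupportedNear (r + N * e) fun n => a n * (Real.sinc (2 * Real.pi * n * e) : ℂ) ^ N := by
  induction N with
  | zero => simpa using h
  | succ N ih =>
    have := ih.mul_sinc he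
    convert this using 1
    · push_cast; ring
    · ext n; ring

lemma SupportedNear.mul_prod_sinc {r : ℝ} {a : ℤ → ℂ} (h : SupportedNear r a) {e : ℕ → ℝ}
    (he : ∀ j, 0 < e j) (N : ℕ → ℕ) (s : Finset ℕ) :
    SupportedNear (r + ∑ j ∈ s, N j * e j)
      fun n => a n * ∏ j ∈ s, (Real.sinc (2 * Real.pi * n * e j) : ℂ) ^ N j := by
  classical
  induction s using Finset.induction_on with
  | empty => simpa using h
  | insert j s hj ih =>
    have := ih.mul_sinc_pow (he j) (N j)
    convert this using 1
    · rw [Finset.sum_insert hj]; ring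
    · ext n; rw [Finset.prod_insert hj]; ring

lemma SupportedNear.mono {r r' : ℝ} {a : ℤ → ℂ} (h : SupportedNear r a) (hr : r ≤ r') :
    SupportedNear r' a :=
  ⟨h.summable, fun x h1 h2 => h.eq_zero x (hr.trans h1) (h2.trans (by linarith))⟩

/-- Fourier coefficients of a multiple of the tent function of width `1 / 8`. -/
noncomputable def tentCoeff (n : ℤ) : ℂ :=
  if n = 0 then (((Real.pi / 4) ^ 2 : ℝ) : ℂ)
  else (((2 - 2 * Real.cos (2 * Real.pi * n * (1 / 8))) / (n : ℝ) ^ 2 : ℝ) : ℂ)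

lemma summable_inv_int_sq : Summable fun n : ℤ => 4 / (n : ℝ) ^ 2 := by
  have := (Real.summable_one_div_int_pow (p := 2)).2 one_lt_two
  exact (this.mul_left 4).congr fun n => by ring

lemma norm_tentCoeff_le {n : ℤ} (hn : n ≠ 0) : ‖tentCoeff n‖ ≤ 4 / (n : ℝ) ^ 2 := by
  rw [tentCoeff, if_neg hn, Complex.norm_real, Real.norm_eq_abs, abs_div, abs_sq]
  gcongr
  rw [abs_le]
  constructor <;> linarith [Real.neg_one_le_cos (2 * Real.pi * n * (1 / 8)),
    Real.cos_le_one (2 * Real.pi * n * (1 / 8))]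

/-- On `[0,1]` the series with coefficients `1 / n ^ 2` is a quadratic (Bernoulli) polynomial, so
its second difference with step 1/8 is constant as long as all three points stay in `[0,1]`. The
zeroth coefficient cancels that constant. -/
lemma supportedNear_tentCoeff : SupportedNear (1 / 8) tentCoeff := by
  constructor
  · rw [← Finset.summable_compl_iff {(0 : ℤ)}]
    refine Summable.of_nonneg_of_le (fun _ => norm_nonneg _)
      (fun n => norm_tentCoeff_le (by simpa using n.2)) (summable_inv_int_sq.subtype _)
  intro x hx1 hx2
  -- The term `n = 0` is zero because division by zero gives zero.
  have key : ∀ y ∈ Set.Icc (0 : ℝ) 1, HasSum (fun n : ℤ => 1 / (n : ℂ) ^ 2 * trigChar n y)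
      ((2 * Real.pi ^ 2 * (y ^ 2 - y + 6⁻¹) : ℝ) : ℂ) := by
    intro y hy
    have := hasSum_one_div_pow_mul_fourier_mul_bernoulliFun le_rfl hy
    convert this using 1
    · ext n
      rw [fourier_coe_apply, trigChar]
      congr 2; push_cast; ring
    · rw [bernoulliFun_two, mul_pow, Complex.I_sq]; push_cast [Nat.factorial]; ring
  have h0 := key x ⟨by linarith, by linarith⟩
  have h1 := key (x + 1 / 8) ⟨by linarith, by linarith⟩
  have h2 := key (x - 1 / 8) ⟨by linarith, by linarith⟩
  have h3 := ((h0.mul_left 2).sub h1).sub h2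
  have h4 := h3.add (hasSum_ite_eq (0 : ℤ) (((Real.pi / 4) ^ 2 : ℝ) : ℂ))
  rw [trigSeries]
  convert h4.tsum_eq using 1
  · refine tsum_congr fun n => ?_
    by_cases hn : n = 0
    · subst hn; simp [tentCoeff, trigChar_zero]
    · rw [tentCoeff, if_neg hn, if_neg hn, sub_eq_add_neg x, trigChar_add, trigChar_add]
      have hc : ((2 * Real.cos (2 * Real.pi * n * (1 / 8)) : ℝ) : ℂ)
          = trigChar n (1 / 8) + trigChar n (-(1 / 8)) := by
        push_cast
        rw [Complex.two_cos, trigChar, trigChar]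
        push_cast; ring_nf
      push_cast at hc ⊢
      rw [hc]
      ring
  · push_cast; ring

lemma trigSeries_mul_half (a : ℤ → ℂ) (x : ℝ) :
    trigSeries (fun n => a n * trigChar n (1 / 2)) x = trigSeries a (x + 1 / 2) := by
  refine tsum_congr fun n => ?_
  rw [trigChar_add]; ring

/-- The twist translates by 1/2, and the open 1/4-neighbourhoods of the integers and of the
half-integers are disjoint. -/
lemma SupportedNear.trigSeries_mul_eq_zero {a : ℤ → ℂ} (h : SupportedNear (1 / 4) a) (x : ℝ) :
    trigSeries a x * trigSeries (fun n => a n * trigChar n (1 / 2)) x = 0 := by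
  rw [trigSeries_mul_half]
  have hx := Int.fract_add_floor x
  have h0 := Int.fract_nonneg x
  have h1 := Int.fract_lt_one x
  rw [← hx, add_right_comm, trigSeries_add_int, trigSeries_add_int]
  set y := Int.fract x
  by_cases hy1 : y < 1 / 4
  · rw [h.eq_zero (y + 1 / 2) (by linarith) (by linarith), mul_zero]
  by_cases hy2 : y ≤ 3 / 4
  · rw [h.eq_zero y (by linarith) (by linarith), zero_mul]
  · have := trigSeries_add_int a (y - 1 / 2) 1
    rw [h.eq_zero (y - 1 / 2) (by linarith) (by linarith)] at this
    have h2 : y - 1 / 2 + ((1 : ℤ) : ℝ) = y + 1 / 2 := by push_cast; ring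
    rw [h2] at this
    rw [this, mul_zero]

/-- The convolution at `k` is the `k`-th Fourier coefficient of the product of the two sums. -/
lemma convolution_eq_zero {a b : ℤ → ℂ} (ha : Summable fun n => ‖a n‖)
    (hb : Summable fun n => ‖b n‖) (h : ∀ x, trigSeries a x * trigSeries b x = 0) (k : ℤ) :
    ∑' n, a n * b (k - n) = 0 := by
  have hs : Summable fun p : ℤ × ℤ => ‖a p.1 * b p.2‖ := ha.mul_norm hb
  have h1 := (hasSum_integral_trigChar (fun p : ℤ × ℤ => a p.1 * b p.2)
    (fun p => p.1 + p.2 + (-k)) hs 0 1).tsum_eq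
  have h2 : ∀ x : ℝ, ∑' p : ℤ × ℤ, a p.1 * b p.2 * trigChar (p.1 + p.2 + (-k)) x = 0 := by
    intro x
    have h3 : ∀ p : ℤ × ℤ, a p.1 * b p.2 * trigChar (p.1 + p.2 + (-k)) x =
        trigChar (-k) x * ((a p.1 * trigChar p.1 x) * (b p.2 * trigChar p.2 x)) := by
      intro p; rw [trigChar_add_left, trigChar_add_left]; ring
    simp only [h3]
    rw [tsum_mul_left, ← tsum_mul_tsum_of_summable_norm
      (f := fun n => a n * trigChar n x) (g := fun n => b n * trigChar n x) (by simpa only [norm_mul_trigChar] using ha) (by simpa only [norm_mul_trigChar] using hb)]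
    change _ * (trigSeries a x * trigSeries b x) = 0
    rw [h, mul_zero]
  simp only [h2, intervalIntegral.integral_zero, integral_trigChar] at h1
  rw [← h1]
  have hs2 : Summable fun p : ℤ × ℤ => a p.1 * b p.2 * if p.1 + p.2 + -k = 0 then (1 : ℂ) else 0 := by
    refine Summable.of_norm (Summable.of_nonneg_of_le (fun _ => norm_nonneg _) (fun p => ?_) hs)
    split_ifs <;> simp; positivity
  rw [hs2.tsum_prod]
  refine tsum_congr fun n => ?_
  rw [tsum_eq_single (k - n)]
  · simp
  · intro m hm
    rw [if_neg, mul_zero]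
    intro h; apply hm; linarith

/-- For every non-quasianalytic growth rate there are two nonzero sequences, absolutely summable
against this rate, whose convolution vanishes. -/
theorem exists_convolution_eq_zero (N : ℕ → ℕ) (hN : Summable fun j => (N j : ℝ) * (1 / 2 ^ j)) :
    ∃ a b : ℤ → ℂ, a 0 ≠ 0 ∧ b 0 ≠ 0 ∧
      (∀ R : ℕ → ℝ, (∀ n, 0 ≤ R n) →
        (∀ j n, 2 ^ j ≤ n → n < 2 ^ (j + 1) → R n ≤ Real.exp (N j)) →
        Summable (fun n => ‖a n‖ * R n.natAbs) ∧ Summable (fun n => ‖b n‖ * R n.natAbs)) ∧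
      ∀ k, ∑' n, a n * b (k - n) = 0 := by
  -- Averaging `N j` times at scale `1 / 2 ^ j` for `j ≥ J` widens the support by at most 1/8, from
  -- 1/8 to 1/4.
  obtain ⟨s, hs⟩ := summable_iff_vanishing_norm.1 hN (1 / 8) (by norm_num)
  obtain ⟨J, hJ⟩ : ∃ J, ∀ j ∈ s, j < J :=
    ⟨s.sup id + 1, fun j hj => Nat.lt_succ_of_le (Finset.le_sup (f := id) hj)⟩
  have htail : ∀ K, ∑ j ∈ Finset.Ico J K, (N j : ℝ) * (1 / 2 ^ j) ≤ 1 / 8 := fun K =>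
    (le_abs_self _).trans (hs _ (Finset.disjoint_left.2 fun j hj hj' =>
      absurd (hJ j hj') (not_lt.2 (Finset.mem_Ico.1 hj).1))).le
  set A : ℕ → ℤ → ℂ := fun K n => tentCoeff n *
    ∏ j ∈ Finset.Ico J K, (Real.sinc (2 * Real.pi * n * (1 / 2 ^ j)) : ℂ) ^ N j with hA
  have hAs : ∀ K, SupportedNear (1 / 4) (A K) := fun K =>
    (supportedNear_tentCoeff.mul_prod_sinc (e := fun j => 1 / 2 ^ j) (fun j => by positivity) N
      (Finset.Ico J K)).mono (by have := htail K; norm_num at this ⊢; linarith)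
  have hfac : ∀ (j : ℕ) (n : ℤ), ‖(Real.sinc (2 * Real.pi * n * (1 / 2 ^ j)) : ℂ) ^ N j‖ ≤ 1 := by
    intro j n
    rw [norm_pow, Complex.norm_real]
    exact pow_le_one₀ (norm_nonneg _) (Real.abs_sinc_le_one _)
  have hA1 : ∀ K n, ‖A K n‖ ≤ ‖tentCoeff n‖ := by
    intro K n
    rw [hA, norm_mul, norm_prod]
    exact mul_le_of_le_one_right (norm_nonneg _)
      (Finset.prod_le_one (fun _ _ => norm_nonneg _) fun j _ => hfac j n)
  have hA2 : ∀ (j : ℕ) (n : ℤ) (K : ℕ), J ≤ j → 2 ^ j ≤ n.natAbs → j < K →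
      ‖A K n‖ ≤ 4 / (n : ℝ) ^ 2 * Real.exp (-N j) := by
    intro j n K hj hn hK
    have hn0 : n ≠ 0 := by
      rintro rfl
      simp at hn
    rw [hA, norm_mul, norm_prod]
    refine mul_le_mul (norm_tentCoeff_le hn0) ?_ (Finset.prod_nonneg fun _ _ => norm_nonneg _)
      (by positivity)
    rw [← Finset.mul_prod_erase _ _ (Finset.mem_Ico.2 ⟨hj, hK⟩)]
    -- For `|n| ≥ 2 ^ j` the argument of sinc is at least `2π > e` in absolute value, so each of the
    -- `N j` factors is at most `1 / e`.
    have h1 : ‖(Real.sinc (2 * Real.pi * n * (1 / 2 ^ j)) : ℂ) ^ N j‖ ≤ Real.exp (-N j) := by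
      rw [norm_pow, Complex.norm_real, Real.norm_eq_abs, ← mul_neg_one, Real.exp_nat_mul]
      refine pow_le_pow_left₀ (abs_nonneg _) ?_ _
      have hn1 : (1 : ℝ) ≤ |(n : ℝ)| * (1 / 2 ^ j) := by
        rw [mul_one_div, le_div_iff₀ (by positivity), one_mul, ← Int.cast_abs, Int.abs_eq_natAbs]
        exact_mod_cast hn
      have hpi : Real.exp 1 ≤ |2 * Real.pi * n * (1 / 2 ^ j)| := by
        rw [mul_assoc, abs_mul, abs_mul (n : ℝ), abs_of_pos (by positivity : 0 < 2 * Real.pi),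
          abs_of_pos (by positivity : (0 : ℝ) < 1 / 2 ^ j)]
        have := Real.exp_one_lt_d9
        have := Real.pi_gt_three
        nlinarith
      have hx0 : 2 * Real.pi * n * (1 / 2 ^ j) ≠ 0 := by
        intro h; rw [h, abs_zero] at hpi; exact absurd hpi (not_le.2 (Real.exp_pos _))
      rw [Real.sinc_of_ne_zero hx0, abs_div, Real.exp_neg, div_eq_mul_inv]
      calc _ ≤ 1 * |2 * Real.pi * n * (1 / 2 ^ j)|⁻¹ := by
            gcongr; exact Real.abs_sin_le_one _
        _ ≤ _ := by rw [one_mul]; gcongr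
    calc _ ≤ Real.exp (-N j) * 1 := mul_le_mul h1 (Finset.prod_le_one (fun _ _ => norm_nonneg _)
          fun j _ => hfac j n) (Finset.prod_nonneg fun _ _ => norm_nonneg _) (Real.exp_pos _).le
      _ = _ := mul_one _
  -- A limit along an ultrafilter stands in for the infinite product; no convergence proof is
  -- needed.
  have hlim : ∀ n, ∃ z, Tendsto (fun K => A K n) (hyperfilter ℕ : Filter ℕ) (𝓝 z) := by
    intro n
    obtain ⟨z, -, hz⟩ := (isCompact_closedBall (0 : ℂ) ‖tentCoeff n‖).ultrafilter_le_nhds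
      ((hyperfilter ℕ).map fun K => A K n)
      (by
        rw [le_principal_iff]
        exact mem_map.2 (Filter.univ_mem' fun K : ℕ => by simpa using hA1 K n))
    exact ⟨z, hz⟩
  choose a ha using hlim
  have ha1 : ∀ n, ‖a n‖ ≤ ‖tentCoeff n‖ := fun n =>
    le_of_tendsto (ha n).norm (.of_forall fun K => hA1 K n)
  have ha2 : ∀ (j : ℕ) (n : ℤ), J ≤ j → 2 ^ j ≤ n.natAbs →
      ‖a n‖ ≤ 4 / (n : ℝ) ^ 2 * Real.exp (-N j) := by
    intro j n hj hn
    refine le_of_tendsto (ha n).norm (Nat.hyperfilter_le_atTop ?_)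
    filter_upwards [eventually_gt_atTop j] with K hK using hA2 j n K hj hn hK
  have has : Summable fun n => ‖a n‖ :=
    Summable.of_nonneg_of_le (fun _ => norm_nonneg _) ha1 supportedNear_tentCoeff.summable
  have hsupp : SupportedNear (1 / 4) a := by
    refine ⟨has, fun x hx1 hx2 => ?_⟩
    have h1 : Tendsto (fun K => trigSeries (A K) x) (hyperfilter ℕ : Filter ℕ)
        (𝓝 (trigSeries a x)) :=
      tendsto_tsum_of_dominated_convergence supportedNear_tentCoeff.summable
        (fun n => (ha n).mul_const _)
        (.of_forall fun K n => by rw [norm_mul_trigChar]; exact hA1 K n)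
    refine tendsto_nhds_unique h1 ?_
    simp only [(hAs _).eq_zero x hx1 hx2, tendsto_const_nhds]
  have ha0 : a 0 ≠ 0 := by
    have : a 0 = tentCoeff 0 := by
      refine tendsto_nhds_unique (ha 0) ?_
      simp [hA]
    rw [this, tentCoeff, if_pos rfl]
    exact_mod_cast (by positivity : (Real.pi / 4) ^ 2 ≠ 0)
  have hR : ∀ R : ℕ → ℝ, (∀ n, 0 ≤ R n) →
      (∀ j n, 2 ^ j ≤ n → n < 2 ^ (j + 1) → R n ≤ Real.exp (N j)) →
      Summable (fun n => ‖a n‖ * R n.natAbs) := by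
    intro R hR0 hR
    refine Summable.of_norm_bounded_eventually summable_inv_int_sq ?_
    have hfin : (Set.Icc (-2 ^ J : ℤ) (2 ^ J)).Finite := Set.finite_Icc _ _
    filter_upwards [hfin.compl_mem_cofinite] with n hn
    have hn' : 2 ^ J ≤ n.natAbs := by
      by_contra hlt
      apply hn
      have : (n.natAbs : ℤ) < 2 ^ J := by exact_mod_cast not_le.1 hlt
      rw [Set.mem_Icc]; omega
    have hn0 : n.natAbs ≠ 0 := by
      have := Nat.two_pow_pos J; omega
    have hj1 := Nat.pow_log_le_self 2 hn0
    have hj2 := Nat.lt_pow_succ_log_self one_lt_two n.natAbs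
    have hjJ : J ≤ Nat.log 2 n.natAbs := (Nat.le_log_iff_pow_le one_lt_two hn0).2 hn'
    rw [Real.norm_of_nonneg (mul_nonneg (norm_nonneg _) (hR0 _))]
    calc _ ≤ 4 / (n : ℝ) ^ 2 * Real.exp (-N (Nat.log 2 n.natAbs))
          * Real.exp (N (Nat.log 2 n.natAbs)) :=
          mul_le_mul (ha2 _ n hjJ hj1) (hR _ _ hj1 hj2) (hR0 _) (by positivity)
      _ = _ := by rw [mul_assoc, ← Real.exp_add, neg_add_cancel, Real.exp_zero, mul_one]
  -- The second sequence is `a` twisted by `(-1) ^ n`, which keeps the absolute values.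
  refine ⟨a, fun n => a n * trigChar n (1 / 2), ha0, by simpa [trigChar_zero] using ha0,
    fun R h0 h => ⟨hR R h0 h, by simpa only [norm_mul_trigChar] using hR R h0 h⟩,
    convolution_eq_zero has (by simpa only [norm_mul_trigChar] using has)
      hsupp.trigSeries_mul_eq_zero⟩

namespace WeightedComposition

/-! ### A Koksma inequality for truncated logarithms -/

/-- The length of `[c - r, c + r) ∩ [0, 1)`. -/
noncomputable def arcLength (c r : ℝ) : ℝ := min (c + r) 1 - max (c - r) 0

/-- The integral of `t ↦ log |t - c|` over `[0, 1]`, written as a layer-cake integral. -/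
noncomputable def meanLog (c : ℝ) : ℝ := -∫ r in (0 : ℝ)..1, arcLength c r / r

lemma abs_arcLength_le {c r : ℝ} (hc : c ∈ Set.Icc (0 : ℝ) 1) (hr : 0 ≤ r) :
    |arcLength c r| ≤ 2 * r := by
  obtain ⟨h0, h1⟩ := hc
  rw [arcLength, abs_le]
  rcases min_cases (c + r) 1 with h | h <;> rcases max_cases (c - r) 0 with h' | h' <;>
    constructor <;> linarith

lemma norm_arcLength_div_le {c r : ℝ} (hc : c ∈ Set.Icc (0 : ℝ) 1) (hr : 0 < r) :
    ‖arcLength c r / r‖ ≤ 2 := by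
  rw [norm_div, Real.norm_eq_abs, Real.norm_of_nonneg hr.le, div_le_iff₀ hr]
  exact abs_arcLength_le hc hr.le

lemma intervalIntegrable_arcLength_div {c : ℝ} (hc : c ∈ Set.Icc (0 : ℝ) 1) {a b : ℝ}
    (ha : 0 ≤ a) (hab : a ≤ b) :
    IntervalIntegrable (fun r => arcLength c r / r) volume a b := by
  refine (intervalIntegrable_const (c := (2 : ℝ))).mono_fun' ?_ ?_
  · unfold arcLength
    exact Measurable.aestronglyMeasurable (by fun_prop)
  · rw [Set.uIoc_of_le hab]
    exact (ae_restrict_mem measurableSet_Ioc).mono fun r hr =>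
      norm_arcLength_div_le hc (ha.trans_lt hr.1)

/-- Layer cake: `-log M` is the integral of `1 / r` over `[M, 1]`, and `r > |t - c|` says that `t`
lies in the interval of radius `r` around `c`, except at the single radius `r = |t - c|`. -/
lemma log_max_eq_integral {c t δ : ℝ} (hc : c ∈ Set.Icc (0 : ℝ) 1) (ht : t ∈ Set.Ico (0 : ℝ) 1)
    (hδ : 0 < δ) (hδ1 : δ ≤ 1) :
    IntervalIntegrable
      (fun r => if t ∈ Set.Ico (max (c - r) 0) (min (c + r) 1) then 1 / r else 0) volume δ 1 ∧
    Real.log (max |t - c| δ) =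
      -∫ r in δ..1, if t ∈ Set.Ico (max (c - r) 0) (min (c + r) 1) then 1 / r else 0 := by
  set M := max |t - c| δ with hM
  have hM0 : 0 < M := hδ.trans_le (le_max_right _ _)
  have htc : |t - c| ≤ 1 := by
    rw [abs_le]; constructor <;> linarith [hc.1, hc.2, ht.1, ht.2]
  have hM1 : M ≤ 1 := max_le htc hδ1
  have hae : ∀ᵐ r ∂volume, r ∈ Set.Ioc δ 1 →
      (if t ∈ Set.Ico (max (c - r) 0) (min (c + r) 1) then 1 / r else 0)
        = (Set.Ioc M 1).indicator (fun r => 1 / r) r := by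
    have : ∀ᵐ r ∂(volume : Measure ℝ), r ≠ |t - c| := by simp [ae_iff]
    filter_upwards [this] with r hr hr1
    have hiff : t ∈ Set.Ico (max (c - r) 0) (min (c + r) 1) ↔ r ∈ Set.Ioc M 1 := by
      simp only [Set.mem_Ico, Set.mem_Ioc, max_le_iff, lt_min_iff, hM, max_lt_iff]
      constructor
      · rintro ⟨⟨h1, -⟩, h2, -⟩
        refine ⟨⟨lt_of_le_of_ne ?_ hr.symm, hr1.1⟩, hr1.2⟩
        rw [abs_le]; constructor <;> linarith
      · rintro ⟨⟨h1, -⟩, -⟩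
        rw [abs_lt] at h1
        exact ⟨⟨by linarith, ht.1⟩, by linarith, ht.2⟩
    by_cases h : t ∈ Set.Ico (max (c - r) 0) (min (c + r) 1)
    · rw [if_pos h, Set.indicator_of_mem (hiff.1 h)]
    · rw [if_neg h, Set.indicator_of_notMem (mt hiff.2 h)]
  have hinter : Set.Ioc δ 1 ∩ Set.Ioc M 1 = Set.Ioc M 1 :=
    Set.inter_eq_right.2 (Set.Ioc_subset_Ioc_left (le_max_right _ _))
  constructor
  · rw [intervalIntegrable_iff_integrableOn_Ioc_of_le hδ1]
    refine Integrable.congr (f := (Set.Ioc M 1).indicator fun r => 1 / r) ?_ ?_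
    · rw [integrable_indicator_iff measurableSet_Ioc]
      rw [IntegrableOn, Measure.restrict_restrict measurableSet_Ioc, Set.inter_comm, hinter,
        ← IntegrableOn, ← intervalIntegrable_iff_integrableOn_Ioc_of_le hM1]
      refine intervalIntegral.intervalIntegrable_one_div (fun x hx => ?_) continuousOn_id
      rw [Set.uIcc_of_le hM1] at hx
      exact (hM0.trans_le hx.1).ne'
    · exact ((ae_restrict_iff' measurableSet_Ioc).2 hae).mono fun _ h => h.symm
  · rw [intervalIntegral.integral_of_le hδ1, setIntegral_congr_ae measurableSet_Ioc hae,
      setIntegral_indicator measurableSet_Ioc, hinter, ← intervalIntegral.integral_of_le hM1,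
      integral_one_div_of_pos hM0 one_pos, one_div, Real.log_inv, neg_neg]

lemma visitCount_eq_sum (N : ℕ) (E : Set ℝ) [DecidablePred (· ∈ E)] (ω : ℕ → ℝ) :
    (visitCount N E ω : ℝ) = ∑ k ∈ Finset.Icc 1 N, if ω k ∈ E then 1 else 0 := by
  rw [Finset.sum_boole, visitCount, ← Set.ncard_coe_finset]
  congr 2
  ext n
  simp [and_assoc]

/-- Integrating the discrepancy bound for the interval of radius `r` against `dr / r` over `[δ, 1]`
gives `D * -log δ`. The part of `meanLog` below `δ` is at most `2 * δ`, as `arcLength c r ≤ 2 * r`.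
-/
lemma abs_sum_log_max_sub_le {ω : ℕ → ℝ} {n : ℕ} {D c δ : ℝ} (hn : 0 < n)
    (hω : ∀ k ∈ Finset.Icc 1 n, ω k ∈ Set.Ico (0 : ℝ) 1)
    (hD : ∀ a b : ℝ, 0 ≤ a → a < b → b ≤ 1 →
      |(visitCount n (Set.Ico a b) ω : ℝ) / n - (b - a)| ≤ D)
    (hc : c ∈ Set.Icc (0 : ℝ) 1) (hδ : 0 < δ) (hδ1 : δ ≤ 1) :
    |∑ k ∈ Finset.Icc 1 n, Real.log (max |ω k - c| δ) - n * meanLog c|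
      ≤ n * (D * -Real.log δ) + n * (2 * δ) := by
  classical
  have hn' : (0 : ℝ) < n := by exact_mod_cast hn
  set χ : ℕ → ℝ → ℝ := fun k r =>
    if ω k ∈ Set.Ico (max (c - r) 0) (min (c + r) 1) then 1 / r else 0 with hχ
  have hint : ∀ k ∈ Finset.Icc 1 n, IntervalIntegrable (χ k) volume δ 1 := fun k hk =>
    (log_max_eq_integral hc (hω k hk) hδ hδ1).1
  have hsum : ∑ k ∈ Finset.Icc 1 n, Real.log (max |ω k - c| δ)
      = -∫ r in δ..1, ∑ k ∈ Finset.Icc 1 n, χ k r := by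
    rw [intervalIntegral.integral_finsetSum hint, ← Finset.sum_neg_distrib]
    exact Finset.sum_congr rfl fun k hk => (log_max_eq_integral hc (hω k hk) hδ hδ1).2
  have hsplit : ∫ r in (0 : ℝ)..1, arcLength c r / r
      = (∫ r in (0 : ℝ)..δ, arcLength c r / r) + ∫ r in δ..1, arcLength c r / r :=
    (intervalIntegral.integral_add_adjacent_intervals
      (intervalIntegrable_arcLength_div hc le_rfl hδ.le)
      (intervalIntegrable_arcLength_div hc hδ.le hδ1)).symm
  have h1 : ‖∫ r in (0 : ℝ)..δ, arcLength c r / r‖ ≤ 2 * |δ - 0| := by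
    refine intervalIntegral.norm_integral_le_of_norm_le_const fun r hr => ?_
    rw [Set.uIoc_of_le hδ.le] at hr
    exact norm_arcLength_div_le hc hr.1
  have h2 : ‖∫ r in δ..1, (∑ k ∈ Finset.Icc 1 n, χ k r - n * (arcLength c r / r))‖
      ≤ ∫ r in δ..1, n * D * (1 / r) := by
    refine intervalIntegral.norm_integral_le_of_norm_le hδ1 (.of_forall fun r hr => ?_) ?_
    · have hr0 : 0 < r := hδ.trans hr.1
      have hab : max (c - r) 0 < min (c + r) 1 := by
        rw [max_lt_iff, lt_min_iff, lt_min_iff]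
        refine ⟨⟨by linarith, ?_⟩, by linarith [hc.1], one_pos⟩
        linarith [hc.2]
      have hd := hD _ _ (le_max_right (c - r) 0) hab (min_le_right (c + r) 1)
      rw [visitCount_eq_sum] at hd
      have hχsum : ∑ k ∈ Finset.Icc 1 n, χ k r = (∑ k ∈ Finset.Icc 1 n,
          if ω k ∈ Set.Ico (max (c - r) 0) (min (c + r) 1) then (1 : ℝ) else 0) / r := by
        rw [Finset.sum_div]
        refine Finset.sum_congr rfl fun k _ => ?_
        simp only [hχ]; split_ifs <;> simp
      rw [hχsum]
      set S := ∑ k ∈ Finset.Icc 1 n,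
          if ω k ∈ Set.Ico (max (c - r) 0) (min (c + r) 1) then (1 : ℝ) else 0
      have : S / r - n * (arcLength c r / r) = n * (S / n - arcLength c r) * (1 / r) := by
        field_simp
      rw [this, norm_mul, norm_mul, Real.norm_of_nonneg hn'.le, Real.norm_eq_abs,
        Real.norm_of_nonneg (by positivity : 0 ≤ 1 / r)]
      gcongr
      exact hd
    · refine IntervalIntegrable.const_mul ?_ _
      refine intervalIntegral.intervalIntegrable_one_div (fun x hx => ?_) continuousOn_id
      rw [Set.uIcc_of_le hδ1] at hx
      exact (hδ.trans_le hx.1).ne'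
  rw [intervalIntegral.integral_const_mul, integral_one_div_of_pos hδ one_pos, one_div,
    Real.log_inv] at h2
  rw [intervalIntegral.integral_sub (by
      have h := IntervalIntegrable.sum _ hint
      rwa [show ∑ k ∈ Finset.Icc 1 n, χ k = fun r => ∑ k ∈ Finset.Icc 1 n, χ k r by
        ext r; simp] at h)
    ((intervalIntegrable_arcLength_div hc hδ.le hδ1).const_mul _),
    intervalIntegral.integral_const_mul] at h2
  rw [hsum, meanLog, hsplit]
  rw [Real.norm_eq_abs, abs_le] at h1 h2
  rw [sub_zero, abs_of_pos hδ] at h1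
  rw [abs_le]
  have h3 := mul_le_mul_of_nonneg_left h1.1 hn'.le
  have h4 := mul_le_mul_of_nonneg_left h1.2 hn'.le
  constructor <;> nlinarith [h2.1, h2.2]

/-! ### Elementary bounds for the discrepancy -/

lemma visitCount_le (N : ℕ) (E : Set ℝ) (ω : ℕ → ℝ) : visitCount N E ω ≤ N := by
  have h : Set.ncard (Finset.Icc 1 N : Set ℕ) = N := by rw [Set.ncard_coe_finset]; simp
  calc visitCount N E ω ≤ Set.ncard (Finset.Icc 1 N : Set ℕ) :=
        Set.ncard_le_ncard (fun n hn => by simpa using ⟨hn.1, hn.2.1⟩) (Finset.finite_toSet _)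
    _ = N := h

/-- Supplies the boundedness without which the suprema defining the discrepancies would take the
default value 0. -/
lemma abs_visitCount_div_sub_le_one (N : ℕ) (ω : ℕ → ℝ) {a b : ℝ} (ha : 0 ≤ a) (hab : a < b)
    (hb : b ≤ 1) : |(visitCount N (Set.Ico a b) ω : ℝ) / N - (b - a)| ≤ 1 := by
  have h1 : (visitCount N (Set.Ico a b) ω : ℝ) / N ≤ 1 :=
    div_le_one_of_le₀ (by exact_mod_cast visitCount_le _ _ _) (Nat.cast_nonneg _)
  have h0 : 0 ≤ (visitCount N (Set.Ico a b) ω : ℝ) / N := by positivity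
  rw [abs_le]; constructor <;> linarith

lemma discrepancy_le_one (N : ℕ) (ω : ℕ → ℝ) : discrepancy N ω ≤ 1 :=
  Real.sSup_le (by rintro r ⟨a, b, ha, hab, hb, rfl⟩; exact abs_visitCount_div_sub_le_one N ω ha hab hb)
    zero_le_one

lemma abs_visitCount_div_sub_le_mapDiscrepancy (τ : I → I) (N : ℕ) {x : I} (hx : (x : ℝ) < 1)
    {a b : ℝ} (ha : 0 ≤ a) (hab : a < b) (hb : b ≤ 1) :
    |(visitCount N (Set.Ico a b) (fun n => ((τ^[n] x : I) : ℝ)) : ℝ) / N - (b - a)|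
      ≤ mapDiscrepancy τ N := by
  calc _ ≤ discrepancy N (fun n => ((τ^[n] x : I) : ℝ)) := by
        refine le_csSup ⟨1, ?_⟩ ⟨a, b, ha, hab, hb, rfl⟩
        rintro r ⟨a, b, ha, hab, hb, rfl⟩
        exact abs_visitCount_div_sub_le_one N _ ha hab hb
    _ ≤ _ := by
        refine le_csSup ⟨1, ?_⟩ ⟨x, hx, rfl⟩
        rintro r ⟨x, -, rfl⟩
        exact discrepancy_le_one _ _

lemma mapDiscrepancy_le_one (τ : I → I) (N : ℕ) : mapDiscrepancy τ N ≤ 1 :=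
  Real.sSup_le (by rintro r ⟨x, -, rfl⟩; exact discrepancy_le_one _ _) zero_le_one

lemma mapDiscrepancy_nonneg (τ : I → I) (N : ℕ) : 0 ≤ mapDiscrepancy τ N :=
  (abs_nonneg _).trans (abs_visitCount_div_sub_le_mapDiscrepancy τ N (x := 0) (by simp)
    le_rfl one_pos le_rfl)

end WeightedComposition

/-! ### Weighted permutations of function spaces -/

section WeightedPerm

variable {X : Type*}

/-- The linear bijection `g ↦ w · (g ∘ f)` of the space of all functions on `X`. -/
def weightedPerm (f : Equiv.Perm X) (w : X → ℂˣ) : Equiv.Perm (X → ℂ) where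
  toFun g x := w x * g (f x)
  invFun g x := ((w (f⁻¹ x))⁻¹ : ℂˣ) * g (f⁻¹ x)
  left_inv g := by ext x; simp
  right_inv g := by ext x; simp

lemma weightedPerm_apply (f : Equiv.Perm X) (w : X → ℂˣ) (g : X → ℂ) (x : X) :
    weightedPerm f w g x = w x * g (f x) := rfl

lemma weightedPerm_inv_apply (f : Equiv.Perm X) (w : X → ℂˣ) (g : X → ℂ) (x : X) :
    (weightedPerm f w)⁻¹ g x = ((w (f⁻¹ x))⁻¹ : ℂˣ) * g (f⁻¹ x) := rfl

/-- The weight acts on one factor only. Hence cutting a function down by an indicator can only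
shrink its orbit. -/
lemma weightedPerm_zpow_mul (f : Equiv.Perm X) (w : X → ℂˣ) (n : ℤ) (g h : X → ℂ) :
    (weightedPerm f w ^ n) (fun x => g x * h x) =
      fun x => (weightedPerm f w ^ n) g x * h ((f ^ n) x) := by
  induction n using Int.induction_on with
  | zero => simp
  | succ n ih =>
    rw [add_comm, zpow_add, zpow_add, zpow_one, Equiv.Perm.mul_apply, ih]
    ext x
    rw [Equiv.Perm.mul_apply, weightedPerm_apply, weightedPerm_apply, ← mul_assoc,
      ← Equiv.Perm.mul_apply (f ^ (n : ℤ)) f, ← zpow_add_one, ← zpow_add, add_comm (1 : ℤ)]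
  | pred n ih =>
    rw [sub_eq_neg_add, zpow_add, zpow_add, zpow_neg_one, Equiv.Perm.mul_apply, ih]
    ext x
    rw [Equiv.Perm.mul_apply, weightedPerm_inv_apply, weightedPerm_inv_apply, ← mul_assoc,
      ← Equiv.Perm.mul_apply (f ^ (-n : ℤ)) f⁻¹, ← zpow_neg_one, ← zpow_add, zpow_neg_one,
      ← zpow_neg_one f, ← zpow_add, add_comm]

lemma weightedPerm_pow_apply (f : Equiv.Perm X) (w : X → ℂˣ) (n : ℕ) (g : X → ℂ) (x : X) :
    (weightedPerm f w ^ n) g x =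
      (∏ k ∈ Finset.range n, (w ((f ^ k) x) : ℂ)) * g ((f ^ n) x) := by
  induction n generalizing x with
  | zero => simp
  | succ n ih =>
    rw [pow_succ', Equiv.Perm.mul_apply, weightedPerm_apply, ih, Finset.prod_range_succ',
      ← mul_assoc, pow_zero, Equiv.Perm.one_apply, mul_comm (w x : ℂ), pow_succ f,
      Equiv.Perm.mul_apply]
    simp only [pow_succ, Equiv.Perm.mul_apply]

lemma weightedPerm_pow_inv_apply (f : Equiv.Perm X) (w : X → ℂˣ) (n : ℕ) (g : X → ℂ) (x : X) :
    (weightedPerm f w ^ n)⁻¹ g x =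
      (∏ k ∈ Finset.range n, (w ((f ^ k) ((f ^ n)⁻¹ x)) : ℂ))⁻¹ * g ((f ^ n)⁻¹ x) := by
  have h := weightedPerm_pow_apply f w n ((weightedPerm f w ^ n)⁻¹ g) ((f ^ n)⁻¹ x)
  rw [← Equiv.Perm.mul_apply, mul_inv_cancel, ← Equiv.Perm.mul_apply (f ^ n), mul_inv_cancel,
    Equiv.Perm.one_apply, Equiv.Perm.one_apply] at h
  rw [h, inv_mul_cancel_left₀]
  exact Finset.prod_ne_zero_iff.2 fun k _ => Units.ne_zero _

/-- The transpose of `weightedPerm f w` for the bilinear pairing given by integration. -/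
def weightedPermTranspose (f : Equiv.Perm X) (w : X → ℂˣ) : Equiv.Perm (X → ℂ) :=
  weightedPerm f⁻¹ fun x => w (f⁻¹ x)

/-- Rewritten along the forward orbit of `f⁻ⁿ x`, so that one estimate of forward products serves
the operator and its transpose. -/
lemma weightedPermTranspose_pow_apply (f : Equiv.Perm X) (w : X → ℂˣ) (n : ℕ) (g : X → ℂ) (x : X) :
    (weightedPermTranspose f w ^ n) g x =
      (∏ k ∈ Finset.range n, (w ((f ^ k) ((f ^ n)⁻¹ x)) : ℂ)) * g ((f ^ n)⁻¹ x) := by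
  rw [weightedPermTranspose, weightedPerm_pow_apply, inv_pow, ← Finset.prod_range_reflect]
  congr 1
  refine Finset.prod_congr rfl fun k hk => ?_
  have hk := Finset.mem_range.1 hk
  rw [← Equiv.Perm.mul_apply, ← Equiv.Perm.mul_apply]
  congr 3
  rw [← pow_succ', inv_pow, eq_mul_inv_iff_mul_eq, inv_mul_eq_iff_eq_mul, ← pow_add]
  congr 1; omega

lemma weightedPermTranspose_pow_inv_apply (f : Equiv.Perm X) (w : X → ℂˣ) (n : ℕ) (g : X → ℂ)
    (x : X) :
    (weightedPermTranspose f w ^ n)⁻¹ g x =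
      (∏ k ∈ Finset.range n, (w ((f ^ k) x) : ℂ))⁻¹ * g ((f ^ n) x) := by
  have h := weightedPermTranspose_pow_apply f w n ((weightedPermTranspose f w ^ n)⁻¹ g) ((f ^ n) x)
  rw [← Equiv.Perm.mul_apply, mul_inv_cancel, ← Equiv.Perm.mul_apply (f ^ n)⁻¹, inv_mul_cancel,
    Equiv.Perm.one_apply, Equiv.Perm.one_apply] at h
  rw [h, inv_mul_cancel_left₀]
  exact Finset.prod_ne_zero_iff.2 fun k _ => Units.ne_zero _

variable [MeasurableSpace X]

lemma measurable_weightedPerm_zpow {f : Equiv.Perm X} (hf : Measurable f)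
    (hf' : Measurable (f⁻¹ : Equiv.Perm X)) {w : X → ℂˣ} (hw : Measurable fun x => (w x : ℂ))
    {g : X → ℂ} (hg : Measurable g) (n : ℤ) : Measurable ((weightedPerm f w ^ n) g) := by
  induction n using Int.induction_on with
  | zero => simpa
  | succ n ih =>
    rw [add_comm, zpow_add, zpow_one, Equiv.Perm.mul_apply]
    exact hw.mul (ih.comp hf)
  | pred n ih =>
    rw [sub_eq_neg_add, zpow_add, zpow_neg_one, Equiv.Perm.mul_apply]
    have : (weightedPerm f w)⁻¹ ((weightedPerm f w ^ (-n : ℤ)) g) = fun x =>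
        ((w (f⁻¹ x) : ℂ))⁻¹ * (weightedPerm f w ^ (-n : ℤ)) g (f⁻¹ x) := by
      ext x; rw [weightedPerm_inv_apply, Units.val_inv_eq_inv_val]
    rw [this]
    exact (hw.comp hf').inv.mul (ih.comp hf')

end WeightedPerm

/-! ### Series of bounded functions -/

section Series

variable {X : Type*} [MeasurableSpace X] {μ : Measure X}

/-- A nonzero weighted sum along free orbits does not vanish on all open sets at once. -/
lemma exists_isOpen_not_ae_tsum_eq_zero [TopologicalSpace X] [SecondCountableTopology X] [T1Space X]
    {c : ℤ → X → ℂ} {θ : ℤ → X → X} {u : ℤ → ℝ} {α : ℂ} (hα : α ≠ 0) {E : Set X} (hE : μ E ≠ 0)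
    (hu : Summable u) (hcu : ∀ n, ∀ᵐ x ∂μ, ‖c n x‖ ≤ u n) (hc0 : ∀ x ∈ E, c 0 x = α)
    (hθ0 : ∀ x, θ 0 x = x) (hθ : ∀ᵐ x ∂μ, ∀ n, n ≠ 0 → θ n x ≠ x) :
    ∃ A : Set X, IsOpen A ∧ ¬ ∀ᵐ x ∂μ, ∑' n, c n x * A.indicator 1 (θ n x) = 0 := by
  classical
  by_contra! hcon
  set B := TopologicalSpace.countableBasis X
  have hB : TopologicalSpace.IsTopologicalBasis B := TopologicalSpace.isBasis_countableBasis X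
  -- A countable basis gives one null set for all basic open sets.
  have h1 : ∀ᵐ x ∂μ, ∀ A ∈ B, ∑' n, c n x * A.indicator 1 (θ n x) = 0 :=
    (ae_ball_iff (TopologicalSpace.countable_countableBasis X)).2 fun A hA => hcon A (hB.isOpen hA)
  have h2 : ∀ᵐ x ∂μ, x ∉ E := by
    filter_upwards [h1, hθ, ae_all_iff.2 hcu] with x h1 hθ hcu hxE
    -- Basic neighbourhoods shrinking to `x`: since `θ n x ≠ x` for `n ≠ 0`, dominated convergence
    -- leaves only the term `n = 0`, which is `α`.
    set F : Filter (Set X) := (𝓝 x).smallSets ⊓ 𝓟 {A | x ∈ A ∧ A ∈ B} with hF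
    have hne : F.NeBot := by
      rw [hF, Filter.inf_principal_neBot_iff]
      intro U hU
      obtain ⟨s, hs, hsU⟩ := Filter.eventually_smallSets.1 hU
      obtain ⟨A, hA, hxA, hAs⟩ := hB.mem_nhds_iff.1 hs
      exact ⟨A, hsU A hAs, hxA, hA⟩
    have hlim : Tendsto (fun A : Set X => ∑' n, c n x * A.indicator 1 (θ n x)) F
        (𝓝 (∑' n : ℤ, if n = 0 then α else 0)) := by
      refine tendsto_tsum_of_dominated_convergence hu (fun n => ?_) ?_
      · refine tendsto_const_nhds.congr' ?_
        split_ifs with hn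
        · subst hn
          filter_upwards [mem_inf_of_right (mem_principal_self _)] with A hA
          rw [hθ0, Set.indicator_of_mem hA.1, hc0 x hxE, Pi.one_apply, mul_one]
        · have : ∀ᶠ A in (𝓝 x).smallSets, θ n x ∉ A :=
            Filter.eventually_smallSets.2 ⟨{θ n x}ᶜ, isOpen_compl_singleton.mem_nhds (hθ n hn).symm,
              fun A hA hmem => hA hmem rfl⟩
          filter_upwards [mem_inf_of_left this] with A hA
          rw [Set.indicator_of_notMem hA, mul_zero]
      · refine .of_forall fun A n => ?_
        rw [norm_mul]
        refine (mul_le_of_le_one_right (norm_nonneg _) ?_).trans (hcu n)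
        by_cases h : θ n x ∈ A <;> simp [h]
    have hlim0 : Tendsto (fun A : Set X => ∑' n, c n x * A.indicator 1 (θ n x)) F (𝓝 0) := by
      refine tendsto_const_nhds.congr' ?_
      filter_upwards [mem_inf_of_right (mem_principal_self _)] with A hA
      exact (h1 A hA.2).symm
    have := tendsto_nhds_unique hlim hlim0
    rw [tsum_ite_eq] at this
    exact hα this
  exact hE (measure_eq_zero_iff_ae_notMem.2 h2)

end Series

/-! ### From orbit growth to hyperinvariant subspaces -/

section Hyperinvariant

variable {X : Type*} [MeasurableSpace X] [TopologicalSpace X] [SecondCountableTopology X]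
  [T1Space X] [OpensMeasurableSpace X] {μ : Measure X} [IsFiniteMeasure μ]

/-- The starting function is the indicator of `E ∩ A` with a suitable open `A`. Pointwise bounds on
the orbit of the indicator of `E` persist, and give `L^q` bounds since the measure is finite. -/
lemma exists_orbit_tsum_smul_ne_zero {f : Equiv.Perm X} (hf : Measurable f)
    (hf' : Measurable (f⁻¹ : Equiv.Perm X)) {w : X → ℂˣ} (hw : Measurable fun x => (w x : ℂ))
    {E : Set X} (hE : MeasurableSet E) (hE0 : μ E ≠ 0) {a : ℤ → ℂ} (ha : a 0 ≠ 0) {R : ℕ → ℝ}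
    (hR0 : ∀ n, 0 ≤ R n) (hR : Summable fun n => ‖a n‖ * R n.natAbs)
    (hER : ∀ n : ℤ, ∀ᵐ x ∂μ, ‖(weightedPerm f w ^ n) (E.indicator 1) x‖ ≤ R n.natAbs)
    (hfree : ∀ᵐ x ∂μ, ∀ n : ℤ, n ≠ 0 → (f ^ n) x ≠ x) (q : ℝ≥0∞) [Fact (1 ≤ q)] :
    ∃ (g : X → ℂ) (ξ : ℤ → Lp ℂ q μ) (K : ℝ), 0 ≤ K ∧
      (∀ n, ξ n =ᵐ[μ] (weightedPerm f w ^ n) g) ∧ (∀ n, ‖ξ n‖ ≤ K * R n.natAbs) ∧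
      (Summable fun n => ‖a n • ξ n‖) ∧ ∑' n, a n • ξ n ≠ 0 := by
  obtain ⟨A, hA, hne⟩ := exists_isOpen_not_ae_tsum_eq_zero (μ := μ) ha hE0 hR
    (c := fun n x => a n * (weightedPerm f w ^ n) (E.indicator 1) x) (θ := fun n => ⇑(f ^ n))
    (fun n => by
      filter_upwards [hER n] with x hx
      rw [norm_mul]; gcongr)
    (fun x hx => by simp [hx]) (fun x => by simp) hfree
  set g : X → ℂ := fun x => E.indicator 1 x * A.indicator 1 x with hg
  have hgm : Measurable g :=
    (measurable_one.indicator hE).mul (measurable_one.indicator hA.measurableSet)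
  have hU : ∀ (n : ℤ) x, (weightedPerm f w ^ n) g x =
      (weightedPerm f w ^ n) (E.indicator 1) x * A.indicator 1 ((f ^ n) x) := fun n x => by
    rw [hg, weightedPerm_zpow_mul]
  have hb : ∀ n : ℤ, ∀ᵐ x ∂μ, ‖(weightedPerm f w ^ n) g x‖ ≤ R n.natAbs := by
    intro n
    filter_upwards [hER n] with x hx
    rw [hU, norm_mul]
    refine (mul_le_of_le_one_right (norm_nonneg _) ?_).trans hx
    by_cases h : (f ^ n) x ∈ A <;> simp [h]
  have hm : ∀ n : ℤ, MemLp ((weightedPerm f w ^ n) g) q μ := fun n =>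
    MemLp.of_bound (measurable_weightedPerm_zpow hf hf' hw hgm n).aestronglyMeasurable _ (hb n)
  set K : ℝ := (measureUnivNNReal μ : ℝ) ^ q.toReal⁻¹
  have hK : 0 ≤ K := by positivity
  have hnorm : ∀ n : ℤ, ‖(hm n).toLp _‖ ≤ K * R n.natAbs := fun n => by
    refine Lp.norm_le_of_ae_bound (hR0 _) ?_
    filter_upwards [hb n, (hm n).coeFn_toLp] with x hx h1
    rwa [h1]
  have hs : Summable fun n : ℤ => ‖a n • (hm n).toLp _‖ := by
    refine Summable.of_nonneg_of_le (fun _ => norm_nonneg _) (fun n => ?_) (hR.mul_left K)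
    rw [norm_smul]
    calc _ ≤ ‖a n‖ * (K * R n.natAbs) := by gcongr; exact hnorm n
      _ = _ := by ring
  refine ⟨g, fun n => (hm n).toLp _, K, hK, fun n => (hm n).coeFn_toLp, hnorm, hs, fun h0 => hne ?_⟩
  have h1 := Lp.coeFn_tsum (f := fun n : ℤ => a n • (hm n).toLp _)
    (ENNReal.tsum_coe_ne_top_iff_summable.2 (NNReal.summable_coe.1 hs))
  rw [h0] at h1
  filter_upwards [h1, Lp.coeFn_zero ℂ q μ, ae_all_iff.2 fun n => (hm n).coeFn_toLp,
    ae_all_iff.2 fun n => Lp.coeFn_smul (a n) ((hm n).toLp _)] with x h1 h2 h3 h4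
  rw [h2] at h1
  rw [Pi.zero_apply] at h1
  refine Eq.trans (tsum_congr fun n => ?_) h1.symm
  rw [h4, Pi.smul_apply, h3, hU, smul_eq_mul, mul_assoc]

/-- Regrouping along `n + m = k` produces the factor `(a * b)(k) = 0`. -/
lemma tsum_mul_tsum_mul_eq_zero {a b φ : ℤ → ℂ} (hab : ∀ k, ∑' n, a n * b (k - n) = 0)
    (hs : Summable fun p : ℤ × ℤ => a p.1 * b p.2 * φ (p.1 + p.2)) :
    ∑' n, a n * ∑' m, b m * φ (n + m) = 0 := by
  have h1 : ∑' p : ℤ × ℤ, a p.1 * b p.2 * φ (p.1 + p.2) = ∑' n, a n * ∑' m, b m * φ (n + m) := by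
    rw [hs.tsum_prod]
    refine tsum_congr fun n => ?_
    rw [← tsum_mul_left]
    exact tsum_congr fun m => by ring
  let ψ : ℤ × ℤ ≃ ℤ × ℤ :=
    { toFun := fun p => (p.2, p.1 - p.2)
      invFun := fun p => (p.1 + p.2, p.1)
      left_inv := fun p => by simp
      right_inv := fun p => by simp }
  rw [← h1, ← ψ.tsum_eq]
  have hs' := (ψ.summable_iff).2 hs
  simp only [Function.comp_def] at hs'
  rw [hs'.tsum_prod]
  refine (tsum_congr fun k => ?_).trans tsum_zero
  simp only [ψ, Equiv.coe_fn_mk, add_sub_cancel]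
  rw [tsum_mul_right, hab, zero_mul]

/-- A weighted composition operator over a free measure-preserving transformation has a nontrivial
hyperinvariant subspace if it and its transpose have two-sided orbits of non-quasianalytic
growth. -/
theorem hasNontrivialHyperinvariantSubspace_of_growth {e : X ≃ᵐ X} (he : MeasurePreserving e μ μ)
    {w : X → ℂˣ} (hw : Measurable fun x => (w x : ℂ)) {ζ : ℂ} (hζ : ζ ≠ 0)
    {p : ℝ≥0∞} [Fact (1 ≤ p)] {T : Lp ℂ p μ →L[ℂ] Lp ℂ p μ}
    (hT : ∀ h : Lp ℂ p μ, T h =ᵐ[μ] fun x => ζ * (w x * h (e x)))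
    {E : Set X} (hE : MeasurableSet E) (hE0 : μ E ≠ 0)
    {N : ℕ → ℕ} (hN : Summable fun j => (N j : ℝ) * (1 / 2 ^ j)) {R : ℕ → ℝ} (hR0 : ∀ n, 0 ≤ R n)
    (hRN : ∀ j n, 2 ^ j ≤ n → n < 2 ^ (j + 1) → R n ≤ Real.exp (N j))
    (hER : ∀ n : ℤ, ∀ᵐ x ∂μ, ‖(weightedPerm e.toEquiv w ^ n) (E.indicator 1) x‖ ≤ R n.natAbs)
    (hER' : ∀ n : ℤ, ∀ᵐ x ∂μ,
      ‖(weightedPermTranspose e.toEquiv w ^ n) (E.indicator 1) x‖ ≤ R n.natAbs)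
    (hfree : ∀ᵐ x ∂μ, ∀ n : ℤ, n ≠ 0 → ((e.toEquiv : Equiv.Perm X) ^ n) x ≠ x) :
    WeightedComposition.HasNontrivialHyperinvariantSubspace T := by
  obtain ⟨a, b, ha0, hb0, hab, hconv⟩ := exists_convolution_eq_zero N hN
  obtain ⟨haR, hbR⟩ := hab R hR0 hRN
  -- For `p = ∞` this is `q = 1`. Only the functionals given by `L^q` are used, so every `p` is
  -- treated alike.
  set q := ENNReal.conjExponent p
  have hq : Fact (1 ≤ q) := ⟨ENNReal.HolderConjugate.one_le q p⟩
  set f : Equiv.Perm X := e.toEquiv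
  have hfree' : ∀ᵐ x ∂μ, ∀ n : ℤ, n ≠ 0 → (f⁻¹ ^ n) x ≠ x := by
    filter_upwards [hfree] with x hx n hn
    rw [inv_zpow']
    exact hx _ (neg_ne_zero.2 hn)
  obtain ⟨g, ξ, K, hK, hξ, hξK, hξs, hξ0⟩ := exists_orbit_tsum_smul_ne_zero (f := f) e.measurable
    e.symm.measurable hw hE hE0 ha0 hR0 haR hER hfree p
  obtain ⟨g', η, K', hK', hη, hηK, hηs, hη0⟩ := exists_orbit_tsum_smul_ne_zero (f := f⁻¹)
    e.symm.measurable e.measurable (w := fun x => w (f⁻¹ x)) (hw.comp e.symm.measurable) hE hE0 hb0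
    hR0 hbR hER' hfree' q
  set L := (ContinuousLinearMap.mul ℂ ℂ).lpPairing μ p q with hL
  have hLint : ∀ h y, L h y = ∫ x, h x * y x ∂μ := fun h y => by
    rw [hL, ContinuousLinearMap.lpPairing_eq_integral]; rfl
  have hTξ : ∀ n, T (ξ n) = ζ • ξ (n + 1) := by
    intro n
    refine Lp.ext ?_
    filter_upwards [hT (ξ n), Lp.coeFn_smul ζ (ξ (n + 1)), hξ (n + 1),
      he.quasiMeasurePreserving.ae (hξ n)] with x h1 h2 h3 h4
    rw [h1, h2, Pi.smul_apply, h3, h4, add_comm, zpow_add, zpow_one, Equiv.Perm.mul_apply]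
    rfl
  have hTη : ∀ h m, L (T h) (η m) = ζ * L h (η (m + 1)) := by
    intro h m
    rw [hLint, hLint, ← integral_const_mul, ← (he.symm e).integral_comp']
    refine integral_congr_ae ?_
    filter_upwards [(he.symm e).quasiMeasurePreserving.ae (hT h), hη (m + 1),
      (he.symm e).quasiMeasurePreserving.ae (hη m)] with x h1 h2 h3
    rw [h1, h2, h3, add_comm, zpow_add, zpow_one, Equiv.Perm.mul_apply, weightedPerm_apply,
      MeasurableEquiv.apply_symm_apply]
    change ζ * (w (e.symm x) * h x) * _ = ζ * (h x * (w (e.symm x) * _))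
    ring_nf
    rfl
  set Y := ∑' n, b n • η n
  set Ψ : Lp ℂ p μ →L[ℂ] ℂ := L.flip Y with hΨ
  -- The largest subspace of the kernel of `Ψ` that is invariant under the commutant of `T`.
  let M : Submodule ℂ (Lp ℂ p μ) := ⨅ (S : Lp ℂ p μ →L[ℂ] Lp ℂ p μ) (_ : S.comp T = T.comp S),
    (Ψ.comp S).ker
  have hM : ∀ h, h ∈ M ↔ ∀ S : Lp ℂ p μ →L[ℂ] Lp ℂ p μ, S.comp T = T.comp S → Ψ (S h) = 0 := by
    intro h
    simp only [M, Submodule.mem_iInf]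
    rfl
  refine ⟨M, ?_, ?_, ?_, ?_⟩
  · simp only [M, Submodule.coe_iInf]
    exact isClosed_iInter fun S => isClosed_iInter fun _ => (Ψ.comp S).isClosed_ker
  · have hmem : ∑' n, a n • ξ n ∈ M := by
      rw [hM]
      intro S hS
      -- Moving `T` through `S` and then across the pairing shifts an index from `ξ` to `η`; the
      -- scalar `ζ` cancels.
      have hrec : ∀ n m, L (S (ξ (n + 1))) (η m) = L (S (ξ n)) (η (m + 1)) := by
        intro n m
        have h1 : S (T (ξ n)) = T (S (ξ n)) := DFunLike.congr_fun hS (ξ n)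
        have h2 := hTη (S (ξ n)) m
        rw [← h1, hTξ, map_smul, map_smul, smul_apply, smul_eq_mul] at h2
        exact mul_left_cancel₀ hζ h2
      have hφ : ∀ n m, L (S (ξ n)) (η m) = L (S (ξ 0)) (η (n + m)) := by
        intro n
        induction n using Int.induction_on with
        | zero => intro m; rw [zero_add]
        | succ n ih => intro m; rw [hrec, ih]; congr 2; ring
        | pred n ih =>
          intro m
          have := hrec (-n - 1) (m - 1)
          rw [sub_add_cancel, sub_add_cancel] at this
          rw [← this, ih]; congr 2; ring
      have hsum : L (S (∑' n, a n • ξ n)) Y = ∑' n, a n * ∑' m, b m * L (S (ξ 0)) (η (n + m)) := by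
        have h1 : S (∑' n, a n • ξ n) = ∑' n, a n • S (ξ n) := by
          rw [S.map_tsum hξs.of_norm]; simp
        have h2 : ∀ h, L h Y = ∑' m, b m * L h (η m) := by
          intro h; rw [(L h).map_tsum hηs.of_norm]; simp
        have h3 := (Ψ.comp S).map_tsum hξs.of_norm
        simp only [ContinuousLinearMap.comp_apply, hΨ, ContinuousLinearMap.flip_apply] at h3
        rw [h3]
        refine tsum_congr fun n => ?_
        rw [map_smul, map_smul, smul_apply, smul_eq_mul, h2]
        simp only [hφ n]
      change L (S (∑' n, a n • ξ n)) Y = 0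
      rw [hsum]
      refine tsum_mul_tsum_mul_eq_zero hconv (φ := fun k => L (S (ξ 0)) (η k)) ?_
      refine Summable.of_norm_bounded (g := fun p : ℤ × ℤ =>
        (‖L‖ * ‖S‖ * K * K') * ((‖a p.1‖ * R p.1.natAbs) * (‖b p.2‖ * R p.2.natAbs)))
        (Summable.mul_left _ (haR.mul_of_nonneg hbR
          (fun n => mul_nonneg (norm_nonneg _) (hR0 _))
          fun n => mul_nonneg (norm_nonneg _) (hR0 _))) fun p => ?_
      rw [← hφ, norm_mul, norm_mul]
      calc _ ≤ ‖a p.1‖ * ‖b p.2‖ * (‖L‖ * (‖S‖ * (K * R p.1.natAbs)) * (K' * R p.2.natAbs)) := by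
            refine mul_le_mul_of_nonneg_left ((L.le_opNorm₂ _ _).trans ?_) (by positivity)
            refine mul_le_mul (mul_le_mul_of_nonneg_left ((S.le_opNorm _).trans
              (mul_le_mul_of_nonneg_left (hξK _) (norm_nonneg S))) (by positivity)) (hηK _)
              (norm_nonneg _) ?_
            have := hR0 p.1.natAbs
            positivity
        _ = _ := by ring
    intro hbot
    rw [hbot, Submodule.mem_bot] at hmem
    exact hξ0 hmem
  · intro htop
    have hΨ0 : ∀ h, L h Y = 0 := fun h =>
      (hM h).1 (htop ▸ Submodule.mem_top) (ContinuousLinearMap.id ℂ _) rfl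
    -- With `S` the identity, pairing with indicators of measurable sets forces `Y = 0`.
    refine hη0 (Lp.ext ?_)
    have hY : Integrable Y μ := (Lp.memLp Y).integrable hq.out
    refine (hY.ae_eq_zero_of_forall_setIntegral_eq_zero fun s hs _ => ?_).trans
      (Lp.coeFn_zero ℂ q μ).symm
    have h1 := hΨ0 (indicatorConstLp p hs (measure_ne_top μ s) 1)
    rw [hLint] at h1
    rw [← integral_indicator hs, ← h1]
    refine integral_congr_ae ?_
    filter_upwards [indicatorConstLp_coeFn (p := p) (hs := hs) (hμs := measure_ne_top μ s)
      (c := (1 : ℂ))] with x hx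
    rw [hx]
    by_cases h : x ∈ s <;> simp [h]
  · intro S hS h hh
    rw [hM] at hh ⊢
    intro S' hS'
    refine hh (S'.comp S) ?_
    rw [ContinuousLinearMap.comp_assoc, hS, ← ContinuousLinearMap.comp_assoc, hS',
      ContinuousLinearMap.comp_assoc]

end Hyperinvariant

namespace WeightedComposition

/-! ### Generalized polynomials -/

lemma IsRealPower.abs_eq {t s y : ℝ} (h : IsRealPower t s y) : |y| = |t| ^ s := by
  rcases h with ⟨ht, rfl⟩ | ⟨ht, a, b, hb, rfl, h⟩
  · rw [abs_of_nonneg ht, abs_of_nonneg (Real.rpow_nonneg ht s)]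
  · have hb0 : b ≠ 0 := hb.pos.ne'
    rw [div_eq_mul_inv, Real.rpow_mul (abs_nonneg _), Real.rpow_natCast, ← abs_pow, ← h, abs_pow,
      Real.pow_rpow_inv_natCast (abs_nonneg _) hb0]

/-- Where `h` is negative, the sign of the power is `(-1) ^ a`. It does not depend on how `s = a /
b` is written: `a * b' = a' * b` with `b, b'` odd makes `a` and `a'` of equal parity. -/
lemma measurable_of_isRealPower {α : Type*} [MeasurableSpace α] {h g : α → ℝ} {s : ℝ}
    (hh : Measurable h) (hg : ∀ x, IsRealPower (h x) s (g x)) : Measurable g := by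
  obtain ⟨ν, hsgn⟩ : ∃ ν : ℝ, ∀ x, g x = if h x < 0 then ν * |h x| ^ s else h x ^ s := by
    by_cases hneg : ∃ x₀, h x₀ < 0
    · obtain ⟨x₀, hx₀⟩ := hneg
      rcases hg x₀ with ⟨h0, -⟩ | ⟨-, a, b, hb, hs, -⟩
      · exact absurd hx₀ (not_lt.2 h0)
      refine ⟨(-1) ^ a, fun x => ?_⟩
      rcases hg x with ⟨h0, hy⟩ | ⟨h0, a', b', hb', hs', hy⟩
      · rw [if_neg (not_lt.2 h0), hy]
      rw [if_pos h0]
      have hb0 : (b : ℝ) ≠ 0 := by exact_mod_cast hb.pos.ne'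
      have hb0' : (b' : ℝ) ≠ 0 := by exact_mod_cast hb'.pos.ne'
      have hab : a * b' = a' * b := by
        rw [hs, div_eq_div_iff hb0 hb0'] at hs'
        exact_mod_cast hs'
      have hpar : (-1 : ℝ) ^ a = (-1) ^ a' := by
        calc (-1 : ℝ) ^ a = (-1) ^ (a * b') := by
              rw [mul_comm, pow_mul, hb'.neg_one_pow]
          _ = _ := by rw [hab, mul_comm, pow_mul, hb.neg_one_pow]
      refine hb'.pow_injective ?_
      dsimp only
      rw [hy, mul_pow, hpar, ← pow_mul, mul_comm a' b', pow_mul (-1 : ℝ), hb'.neg_one_pow, hs',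
        ← Real.rpow_natCast (_ ^ _), ← Real.rpow_mul (abs_nonneg _), div_mul_cancel₀ _ hb0',
        Real.rpow_natCast, ← mul_pow, abs_of_neg h0]
      ring
    · push Not at hneg
      refine ⟨1, fun x => ?_⟩
      rw [if_neg (not_lt.2 (hneg x))]
      rcases hg x with ⟨-, hy⟩ | ⟨h0, -⟩
      · exact hy
      · exact absurd h0 (not_lt.2 (hneg x))
  rw [show g = _ from funext hsgn]
  exact Measurable.ite (measurableSet_lt hh measurable_const)
    ((hh.abs.pow_const s).const_mul ν) (hh.pow_const s)

lemma IsGeneralizedPolynomial.measurable_and_norm_eq {v : I → ℂ} (hv : IsGeneralizedPolynomial v) :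
    Measurable v ∧ ∃ (l : ℕ) (A : ℝ) (c : Fin (l + 1) → I) (s : Fin (l + 1) → ℝ), 0 < A ∧
      (∀ j, 0 < s j) ∧ ∀ x : I, ‖v x‖ = A * ∏ j, |(x : ℝ) - c j| ^ s j := by
  obtain ⟨l, C, c, s, h, g, hC, hs, hh, hg, hv⟩ := hv
  constructor
  · rw [show v = _ from funext hv]
    refine measurable_const.mul (Finset.measurable_prod _ fun j _ => ?_)
    refine Complex.measurable_ofReal.comp (measurable_of_isRealPower ?_ (hg j))
    rcases hh j with hj | hj <;> simp only [hj] <;> fun_prop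
  · refine ⟨l, ‖C‖, c, s, norm_pos_iff.2 hC, hs, fun x => ?_⟩
    rw [hv, norm_mul, norm_prod]
    congr 1
    refine Finset.prod_congr rfl fun j _ => ?_
    rw [Complex.norm_real, Real.norm_eq_abs, (hg j x).abs_eq]
    rcases hh j with hj | hj <;> simp [hj]

lemma productWeight_measurable_and_norm_eq {d : ℕ} {v : Fin d → I → ℂ}
    (hv : ∀ i, IsGeneralizedPolynomial (v i)) :
    Measurable (productWeight v) ∧ ∃ (l : Fin d → ℕ) (A : ℝ) (c : (Σ i, Fin (l i + 1)) → I)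
      (s : (Σ i, Fin (l i + 1)) → ℝ), 0 < A ∧ (∀ q, 0 < s q) ∧
      ∀ x, ‖productWeight v x‖ = A * ∏ q, |(x q.1 : ℝ) - c q| ^ s q := by
  refine ⟨Finset.measurable_prod _ fun i _ =>
    (hv i).measurable_and_norm_eq.1.comp (measurable_pi_apply i), ?_⟩
  choose l A c s hA hs h using fun i => (hv i).measurable_and_norm_eq.2
  refine ⟨l, ∏ i, A i, fun q => c q.1 q.2, fun q => s q.1 q.2, Finset.prod_pos fun i _ => hA i,
    fun q => hs q.1 q.2, fun x => ?_⟩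
  rw [productWeight, norm_prod, Fintype.prod_sigma, ← Finset.prod_mul_distrib]
  exact Finset.prod_congr rfl fun i _ => h i _

/-! ### Slabs in the cube -/

lemma volume_slab_le {d : ℕ} (i : Fin d) (c : I) (r : ℝ) :
    volume {x : Fin d → I | |(x i : ℝ) - c| < r} ≤ ENNReal.ofReal (2 * r) := by
  have h1 : volume {t : I | |(t : ℝ) - c| < r} ≤ ENNReal.ofReal (2 * r) := by
    rw [← Real.volume_ball (c : ℝ) r, Measure.Subtype.volume_def,
      comap_subtype_coe_apply measurableSet_Icc]
    refine measure_mono ?_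
    rintro _ ⟨t, ht, rfl⟩
    rwa [Metric.mem_ball, Real.dist_eq]
  have h2 := (measurePreserving_eval (fun _ : Fin d => (volume : Measure I)) i).measure_preimage
    (s := {t : I | |(t : ℝ) - c| < r}) (measurableSet_lt (by fun_prop) (by fun_prop)).nullMeasurableSet
  exact (h2.trans_le h1)

lemma ae_apply_ne {d : ℕ} (i : Fin d) (c : I) :
    ∀ᵐ x : Fin d → I, x i ≠ c := by
  rw [ae_iff]
  refine le_antisymm (ENNReal.le_of_forall_pos_le_add fun r hr _ => ?_) zero_le
  rw [zero_add]
  refine (measure_mono fun x hx => ?_).trans ((volume_slab_le i c (r / 2)).trans ?_)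
  · have : x i = c := by simpa using hx
    simp [this, hr]
  · rw [mul_div_cancel₀ _ two_ne_zero, ENNReal.ofReal_coe_nnreal]

end WeightedComposition

namespace WeightedComposition

/-! ### Growth of the weight along orbits -/

/-- The error term in the Koksma inequality for `n` points of discrepancy `D` and the logarithm
truncated at distance `δ / (n + 1) ^ 2`. -/
noncomputable def koksmaError (δ D : ℝ) (n : ℕ) : ℝ :=
  n * (D * -Real.log (δ / (n + 1) ^ 2)) + n * (2 * (δ / (n + 1) ^ 2))

lemma koksmaError_le {δ D : ℝ} (hδ : 0 < δ) (hδ1 : δ ≤ 1) (hD : 0 ≤ D) {j n : ℕ}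
    (hn : n < 2 ^ (j + 1)) :
    koksmaError δ D n ≤ 2 ^ (j + 1) * (D * (-Real.log δ + 2 * (j + 1))) + 2 := by
  have hn1 : (0 : ℝ) < n + 1 := by positivity
  have hn' : ((n : ℝ) + 1) ≤ 2 ^ (j + 1) := by exact_mod_cast hn
  have hlogn : Real.log (n + 1) ≤ j + 1 := by
    calc Real.log (n + 1) ≤ Real.log (2 ^ (j + 1)) := Real.log_le_log hn1 hn'
      _ = (j + 1) * Real.log 2 := by rw [Real.log_pow]; push_cast; ring
      _ ≤ (j + 1) * 1 := by gcongr; linarith [Real.log_two_lt_d9]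
      _ = _ := mul_one _
  have hlogn0 : 0 ≤ Real.log (n + 1) := Real.log_nonneg (by linarith [Nat.cast_nonneg (α := ℝ) n])
  have hlogδ : 0 ≤ -Real.log δ := by linarith [Real.log_nonpos hδ.le hδ1]
  have h1 : -Real.log (δ / (n + 1) ^ 2) = -Real.log δ + 2 * Real.log (n + 1) := by
    rw [Real.log_div hδ.ne' (by positivity), Real.log_pow]; push_cast; ring
  have h2 : (n : ℝ) * (2 * (δ / (n + 1) ^ 2)) ≤ 2 := by
    have : (n : ℝ) * (δ / (n + 1) ^ 2) ≤ 1 := by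
      rw [← mul_div_assoc, div_le_one (by positivity)]
      nlinarith [Nat.cast_nonneg (α := ℝ) n]
    linarith
  rw [koksmaError, h1]
  have h3 : (n : ℝ) ≤ 2 ^ (j + 1) := by linarith
  gcongr

/-- For `n` near `2 ^ j` the error is of order `2 ^ j * j * Δ n`, up to a constant term, and `Δ n =
O(1 / j ^ 3)`, so `N j / 2 ^ j` is of order `1 / j ^ 2`. -/
lemma exists_dyadic_majorant {δ ε S : ℝ} (hδ : 0 < δ) (hδ1 : δ ≤ 1) (hε : 0 < ε) (hS : 0 ≤ S)
    {Δ : ℕ → ℝ} (hΔ0 : ∀ n, 0 ≤ Δ n) (hΔ1 : ∀ n, Δ n ≤ 1)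
    (hΔ : Δ =O[atTop] fun n : ℕ => 1 / Real.log (n : ℝ) ^ (3 + ε)) :
    ∃ N : ℕ → ℕ, (Summable fun j => (N j : ℝ) * (1 / 2 ^ j)) ∧
      ∀ j n, 2 ^ j ≤ n → n < 2 ^ (j + 1) → S * koksmaError δ (Δ n) n ≤ N j := by
  obtain ⟨C, hC, hΔC⟩ := hΔ.exists_pos
  obtain ⟨n₀, hn₀⟩ := eventually_atTop.1 hΔC.bound
  set K := -Real.log δ + 4 with hK
  have hlogδ : 0 ≤ -Real.log δ := by linarith [Real.log_nonpos hδ.le hδ1]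
  -- The finitely many blocks before the asymptotic range use `Δ n ≤ 1`. The condition `2 ≤ j`
  -- ensures `log n ≥ 1`, and the 8 comes from `log n ≥ j / 2`.
  set F : ℕ → ℝ := fun j => if n₀ ≤ j ∧ 2 ≤ j then
      S * (2 ^ (j + 1) * (C * 8 / (j : ℝ) ^ 3 * (K * j)) + 2)
    else S * (2 ^ (j + 1) * (1 * (-Real.log δ + 2 * (j + 1))) + 2) with hF
  have hF0 : ∀ j, 0 ≤ F j := fun j => by
    simp only [hF, hK]; split_ifs <;> positivity
  refine ⟨fun j => ⌈F j⌉₊, ?_, fun j n hjn hnj => ?_⟩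
  · have hg : Summable fun j : ℕ =>
        (16 * S * C * K) * (1 / (j : ℝ) ^ 2) + (2 * S + 1) * (1 / 2) ^ j :=
      ((Real.summable_one_div_nat_pow.2 one_lt_two).mul_left _).add (summable_geometric_two.mul_left _)
    refine hg.of_norm_bounded_eventually_nat ?_
    filter_upwards [eventually_ge_atTop n₀, eventually_ge_atTop 2] with j h1 h2
    have hj : (0 : ℝ) < j := by exact_mod_cast (by omega : 0 < j)
    rw [Real.norm_of_nonneg (by positivity)]
    have hFj : F j = S * (2 ^ (j + 1) * (C * 8 / (j : ℝ) ^ 3 * (K * j)) + 2) := if_pos ⟨h1, h2⟩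
    calc (⌈F j⌉₊ : ℝ) * (1 / 2 ^ j) ≤ (F j + 1) * (1 / 2 ^ j) := by
          gcongr; exact (Nat.ceil_lt_add_one (hF0 j)).le
      _ = _ := by
          rw [hFj, one_div_pow]; field_simp; ring
  · refine le_trans ?_ (Nat.le_ceil _)
    simp only [hF]
    have hbase := koksmaError_le hδ hδ1 (hΔ0 n) hnj
    split_ifs with h
    · obtain ⟨h1, h2⟩ := h
      refine mul_le_mul_of_nonneg_left (hbase.trans ?_) hS
      have hj2 : (2 : ℝ) ≤ j := by exact_mod_cast h2
      have hn : n₀ ≤ n := h1.trans (Nat.lt_two_pow_self.le.trans hjn)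
      have hlog : (j : ℝ) / 2 ≤ Real.log n := by
        calc (j : ℝ) / 2 ≤ j * Real.log 2 := by nlinarith [Real.log_two_gt_d9]
          _ = Real.log (2 ^ j) := by rw [Real.log_pow]
          _ ≤ Real.log n := Real.log_le_log (by positivity) (by exact_mod_cast hjn)
      have hlog1 : 1 ≤ Real.log n := by linarith
      have hpow : ((j : ℝ) / 2) ^ 3 ≤ Real.log n ^ (3 + ε) := by
        calc ((j : ℝ) / 2) ^ 3 ≤ Real.log n ^ 3 := by gcongr
          _ = Real.log n ^ (3 : ℝ) := by norm_cast
          _ ≤ _ := Real.rpow_le_rpow_of_exponent_le hlog1 (by linarith)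
      have hΔn : Δ n ≤ C * 8 / (j : ℝ) ^ 3 := by
        have := hn₀ n hn
        rw [Real.norm_of_nonneg (hΔ0 n), Real.norm_of_nonneg (by positivity)] at this
        calc Δ n ≤ C * (1 / Real.log n ^ (3 + ε)) := this
          _ ≤ C * (1 / ((j : ℝ) / 2) ^ 3) := by gcongr
          _ = _ := by field_simp; norm_num
      have hKj : -Real.log δ + 2 * (j + 1) ≤ K * j := by rw [hK]; nlinarith
      gcongr
    · refine mul_le_mul_of_nonneg_left (hbase.trans ?_) hS
      gcongr
      exact hΔ1 n

variable {d : ℕ} {τ : Fin d → I → I} {f : Equiv.Perm (Fin d → I)}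

lemma pow_apply_eq_iterate (hf : ∀ x, f x = productMap τ x) (k : ℕ) (x : Fin d → I) (i : Fin d) :
    (f ^ k) x i = (τ i)^[k] (x i) := by
  induction k with
  | zero => rfl
  | succ k ih => rw [pow_succ', Equiv.Perm.mul_apply, hf, productMap, ih, Function.iterate_succ_apply']

/-- The discrepancy counts the times `1, …, n` while the product of weights uses `0, …, n - 1`, so
the orbit is started at `f⁻¹ x`. -/
lemma abs_sum_log_max_orbit_sub_le (hf : ∀ x, f x = productMap τ x) {D δ : ℝ} {i : Fin d} {n : ℕ}
    (hD : mapDiscrepancy (τ i) n ≤ D) (c : I) (hδ : 0 < δ) (hδ1 : δ ≤ 1) {x : Fin d → I}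
    (hx : ∀ k : ℤ, (((f ^ k) x i : I) : ℝ) < 1) :
    |∑ k ∈ Finset.range n, Real.log (max |(((f ^ k) x i : I) : ℝ) - c| (δ / (n + 1) ^ 2))
      - n * meanLog c| ≤ koksmaError δ D n := by
  rcases Nat.eq_zero_or_pos n with rfl | hn
  · simp [koksmaError]
  have hn1 : (1 : ℝ) ≤ (n + 1) ^ 2 := one_le_pow₀ (by linarith [Nat.cast_nonneg (α := ℝ) n])
  have hsum : ∑ k ∈ Finset.range n, Real.log (max |(((f ^ k) x i : I) : ℝ) - c| (δ / (n + 1) ^ 2))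
      = ∑ k ∈ Finset.Icc 1 n,
        Real.log (max |(((τ i)^[k] (f⁻¹ x i) : I) : ℝ) - c| (δ / (n + 1) ^ 2)) := by
    refine Finset.sum_nbij (· + 1) (fun k hk => ?_) (add_left_injective 1).injOn (fun k hk => ?_)
      fun k _ => ?_
    · have := Finset.mem_range.1 hk
      exact Finset.mem_Icc.2 ⟨by omega, by omega⟩
    · have := Finset.mem_Icc.1 hk
      exact ⟨k - 1, Finset.mem_coe.2 (Finset.mem_range.2 (by omega)), by simp; omega⟩
    · rw [← pow_apply_eq_iterate hf, pow_succ f, Equiv.Perm.mul_apply, ← Equiv.Perm.mul_apply f,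
        mul_inv_cancel, Equiv.Perm.one_apply]
  rw [hsum]
  refine abs_sum_log_max_sub_le (ω := fun k => (((τ i)^[k] (f⁻¹ x i) : I) : ℝ)) hn
    (fun k _ => ⟨((τ i)^[k] (f⁻¹ x i)).2.1, ?_⟩)
    (fun a b ha hab hb => (abs_visitCount_div_sub_le_mapDiscrepancy (τ i) n ?_ ha hab hb).trans hD)
    c.2 (by positivity) (div_le_one_of_le₀ (hδ1.trans hn1) (by positivity))
  · have := hx (k - 1)
    rw [← pow_apply_eq_iterate hf, ← Equiv.Perm.mul_apply, ← zpow_natCast, ← zpow_sub_one]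
    exact this
  · have := hx (-1)
    rwa [zpow_neg_one] at this

lemma mapDiscrepancy_le_iSup (τ : Fin d → I → I) (i : Fin d) (n : ℕ) :
    mapDiscrepancy (τ i) n ≤ ⨆ i, mapDiscrepancy (τ i) n :=
  le_ciSup (f := fun i => mapDiscrepancy (τ i) n) (Set.finite_range _).bddAbove i

/-- Orbits on which the discrepancy tends to zero are not periodic. -/
lemma zpow_apply_ne_of_tendsto_mapDiscrepancy (hf : ∀ x, f x = productMap τ x) (i : Fin d)
    (hΔ : Tendsto (fun n => mapDiscrepancy (τ i) n) atTop (𝓝 0)) {x : Fin d → I}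
    (hx : (x i : ℝ) < 1) {n : ℤ} (hn : n ≠ 0) : (f ^ n) x ≠ x := by
  intro hfix
  obtain ⟨N, hN, hNx⟩ : ∃ N : ℕ, 0 < N ∧ (f ^ N) x = x := by
    refine ⟨n.natAbs, Int.natAbs_pos.2 hn, ?_⟩
    rcases Int.natAbs_eq n with h | h
    · rw [h, zpow_natCast] at hfix; exact hfix
    · rw [h, zpow_neg, zpow_natCast, Equiv.Perm.inv_eq_iff_eq] at hfix; exact hfix.symm
  have hper : (τ i)^[N] (x i) = x i := by
    rw [← pow_apply_eq_iterate hf, hNx]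
  have hN' : (0 : ℝ) < N := by exact_mod_cast hN
  -- A point of period `N` visits `[x i, x i + η)` with frequency at least `1 / N`, twice the
  -- permitted length `1 / (2 * N)`.
  set η : ℝ := min (1 / (2 * N)) (1 - x i)
  have hη : 0 < η := lt_min (by positivity) (by linarith)
  have hkey : ∀ K : ℕ, 0 < K → 1 / (2 * (N : ℝ)) ≤ mapDiscrepancy (τ i) (K * N) := by
    intro K hK
    have hK' : (0 : ℝ) < K := by exact_mod_cast hK
    have h1 := abs_visitCount_div_sub_le_mapDiscrepancy (τ i) (K * N) hx (x i).2.1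
      (lt_add_of_pos_right (x i : ℝ) hη) (by linarith [min_le_right (1 / (2 * (N : ℝ))) (1 - x i)])
    have h2 : (K : ℝ) ≤ visitCount (K * N) (Set.Ico (x i : ℝ) (x i + η))
        (fun n => (((τ i)^[n] (x i) : I) : ℝ)) := by
      have hcard : ((Finset.Icc 1 K).image (· * N)).card = K := by
        rw [Finset.card_image_of_injective _ (mul_left_injective₀ hN.ne')]; simp
      have hsub : (((Finset.Icc 1 K).image (· * N) : Finset ℕ) : Set ℕ) ⊆
          {n : ℕ | 1 ≤ n ∧ n ≤ K * N ∧
            (((τ i)^[n] (x i) : I) : ℝ) ∈ Set.Ico (x i : ℝ) (x i + η)} := by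
        intro m hm
        simp only [Finset.coe_image, Set.mem_image, Finset.coe_Icc, Set.mem_Icc] at hm
        obtain ⟨k, ⟨hk1, hk2⟩, rfl⟩ := hm
        refine ⟨Nat.mul_pos hk1 hN, Nat.mul_le_mul_right _ hk2, ?_⟩
        have : (τ i)^[k * N] (x i) = x i := by
          rw [mul_comm, Function.iterate_mul]
          exact Function.iterate_fixed hper k
        rw [this]
        exact ⟨le_rfl, by linarith⟩
      have := Set.ncard_le_ncard hsub
        ((Set.finite_Icc 1 (K * N)).subset fun n hn => ⟨hn.1, hn.2.1⟩)
      rw [Set.ncard_coe_finset, hcard] at this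
      exact_mod_cast this
    have h3 : 1 / (N : ℝ) ≤ visitCount (K * N) (Set.Ico (x i : ℝ) (x i + η))
        (fun n => (((τ i)^[n] (x i) : I) : ℝ)) / ((K * N : ℕ) : ℝ) := by
      rw [Nat.cast_mul, div_le_div_iff₀ hN' (by positivity)]
      nlinarith
    have h4 := (le_abs_self _).trans h1
    have h5 : η ≤ 1 / (2 * N) := min_le_left _ _
    have h6 : 1 / (N : ℝ) = 1 / (2 * N) + 1 / (2 * N) := by field_simp; norm_num
    linarith
  have hlim := hΔ.comp (tendsto_id.atTop_mul_const' hN : Tendsto (fun K : ℕ => K * N) atTop atTop)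
  have h7 : 1 / (2 * (N : ℝ)) ≤ 0 := ge_of_tendsto hlim (by
    filter_upwards [eventually_gt_atTop 0] with K hK using hkey K hK)
  have : 0 < 1 / (2 * (N : ℝ)) := by positivity
  linarith

end WeightedComposition

namespace WeightedComposition

/-! ### Two-sided growth bounds for the weighted orbits -/

section Growth

variable {d : ℕ} {τ : Fin d → I → I} {f : Equiv.Perm (Fin d → I)} {κ : Type*}
  {ι : κ → Fin d} {c : κ → I} {s : κ → ℝ} {w : (Fin d → I) → ℂˣ} {Δ : ℕ → ℝ} {δ : ℝ}

/-- The orbit of `x` avoids the endpoint `1` in all coordinates, and the points `c q`. -/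
def IsGenericPoint (f : Equiv.Perm (Fin d → I)) (ι : κ → Fin d) (c : κ → I) (x : Fin d → I) :
    Prop :=
  (∀ (k : ℤ) i, (((f ^ k) x i : I) : ℝ) < 1) ∧ ∀ (k : ℤ) q, (f ^ k) x (ι q) ≠ c q

/-- The points whose orbit keeps the distance `δ / (|k| + 1) ^ 2` from the points `c q` at
time `k`. -/
def avoidingSet (f : Equiv.Perm (Fin d → I)) (ι : κ → Fin d) (c : κ → I) (δ : ℝ) :
    Set (Fin d → I) :=
  {x | ∀ (k : ℤ) q, δ / (k.natAbs + 1) ^ 2 ≤ |(((f ^ k) x (ι q) : I) : ℝ) - c q|}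

lemma IsGenericPoint.zpow {x : Fin d → I} (hx : IsGenericPoint f ι c x) (m : ℤ) :
    IsGenericPoint f ι c ((f ^ m) x) := by
  refine ⟨fun k i => ?_, fun k q => ?_⟩
  · rw [← Equiv.Perm.mul_apply, ← zpow_add]; exact hx.1 _ _
  · rw [← Equiv.Perm.mul_apply, ← zpow_add]; exact hx.2 _ _

lemma far_of_mem_avoidingSet (hδ : 0 < δ) {z : Fin d → I} (hz : z ∈ avoidingSet f ι c δ) {m : ℤ}
    {n : ℕ} (hm : m.natAbs ≤ n) (q : κ) :
    δ / (n + 1) ^ 2 ≤ |(((f ^ m) z (ι q) : I) : ℝ) - c q| := by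
  refine le_trans ?_ (hz m q)
  have : (m.natAbs : ℝ) ≤ n := by exact_mod_cast hm
  gcongr

lemma norm_mul_indicator_one_le {α : Type*} {E : Set α} {z : ℂ} {x : α} {r : ℝ} (hr : 0 ≤ r)
    (h : x ∈ E → ‖z‖ ≤ r) : ‖z * E.indicator 1 x‖ ≤ r := by
  by_cases hx : x ∈ E
  · simpa [hx] using h hx
  · simpa [hx] using hr

variable [Fintype κ]

lemma log_norm_prod_orbit
    (hw : ∀ x, (∀ q, x (ι q) ≠ c q) →
      Real.log ‖(w x : ℂ)‖ = ∑ q, s q * (Real.log |(x (ι q) : ℝ) - c q| - meanLog (c q)))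
    {x : Fin d → I} (hx : IsGenericPoint f ι c x) (n : ℕ) :
    Real.log ‖∏ k ∈ Finset.range n, (w ((f ^ k) x) : ℂ)‖ =
      ∑ q, s q * (∑ k ∈ Finset.range n, Real.log |(((f ^ k) x (ι q) : I) : ℝ) - c q|
        - n * meanLog (c q)) := by
  rw [norm_prod, Real.log_prod (fun k _ => norm_ne_zero_iff.2 (Units.ne_zero _)),
    Finset.sum_congr rfl fun k _ => hw ((f ^ k) x) (fun q => by simpa using hx.2 k q),
    Finset.sum_comm]
  refine Finset.sum_congr rfl fun q _ => ?_
  rw [← Finset.mul_sum, Finset.sum_sub_distrib]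
  simp

/-- Truncation only increases the logarithm, so the upper bound needs no distance from the zeros. -/
lemma norm_prod_orbit_le (hf : ∀ x, f x = productMap τ x)
    (hw : ∀ x, (∀ q, x (ι q) ≠ c q) →
      Real.log ‖(w x : ℂ)‖ = ∑ q, s q * (Real.log |(x (ι q) : ℝ) - c q| - meanLog (c q)))
    (hs : ∀ q, 0 ≤ s q) (hΔ : ∀ i n, mapDiscrepancy (τ i) n ≤ Δ n) (hδ : 0 < δ) (hδ1 : δ ≤ 1)
    {x : Fin d → I} (hx : IsGenericPoint f ι c x) (n : ℕ) :
    ‖∏ k ∈ Finset.range n, (w ((f ^ k) x) : ℂ)‖ ≤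
      Real.exp ((∑ q, s q) * koksmaError δ (Δ n) n) := by
  have h0 : 0 < ‖∏ k ∈ Finset.range n, (w ((f ^ k) x) : ℂ)‖ :=
    norm_pos_iff.2 (Finset.prod_ne_zero_iff.2 fun k _ => Units.ne_zero _)
  rw [← Real.log_le_iff_le_exp h0, log_norm_prod_orbit hw hx, Finset.sum_mul]
  refine Finset.sum_le_sum fun q _ => mul_le_mul_of_nonneg_left ?_ (hs q)
  have h1 := (abs_le.1 (abs_sum_log_max_orbit_sub_le hf (hΔ (ι q) n) (c q) hδ hδ1
    (fun k => hx.1 k (ι q)))).2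
  refine le_trans (sub_le_sub_right (Finset.sum_le_sum fun k _ => ?_) _) h1
  refine Real.log_le_log (abs_pos.2 (sub_ne_zero.2 ?_)) (le_max_left _ _)
  exact fun h => hx.2 k q (Subtype.ext (by simpa using h))

/-- Under `hfar` the truncation is inactive on this stretch of orbit, so the lower Koksma bound
applies to the true logarithm. -/
lemma norm_inv_prod_orbit_le (hf : ∀ x, f x = productMap τ x)
    (hw : ∀ x, (∀ q, x (ι q) ≠ c q) →
      Real.log ‖(w x : ℂ)‖ = ∑ q, s q * (Real.log |(x (ι q) : ℝ) - c q| - meanLog (c q)))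
    (hs : ∀ q, 0 ≤ s q) (hΔ : ∀ i n, mapDiscrepancy (τ i) n ≤ Δ n) (hδ : 0 < δ) (hδ1 : δ ≤ 1)
    {x : Fin d → I} (hx : IsGenericPoint f ι c x) {n : ℕ}
    (hfar : ∀ k < n, ∀ q, δ / (n + 1) ^ 2 ≤ |(((f ^ k) x (ι q) : I) : ℝ) - c q|) :
    ‖(∏ k ∈ Finset.range n, (w ((f ^ k) x) : ℂ))⁻¹‖ ≤
      Real.exp ((∑ q, s q) * koksmaError δ (Δ n) n) := by
  have h0 : 0 < ‖∏ k ∈ Finset.range n, (w ((f ^ k) x) : ℂ)‖ :=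
    norm_pos_iff.2 (Finset.prod_ne_zero_iff.2 fun k _ => Units.ne_zero _)
  rw [norm_inv, ← Real.log_le_iff_le_exp (inv_pos.2 h0), Real.log_inv, log_norm_prod_orbit hw hx,
    Finset.sum_mul, ← Finset.sum_neg_distrib]
  refine Finset.sum_le_sum fun q _ => ?_
  rw [← mul_neg]
  refine mul_le_mul_of_nonneg_left ?_ (hs q)
  have h1 := (abs_le.1 (abs_sum_log_max_orbit_sub_le hf (hΔ (ι q) n) (c q) hδ hδ1
    (fun k => hx.1 k (ι q)))).1
  rw [Finset.sum_congr rfl fun k hk => by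
    rw [max_eq_left (hfar k (Finset.mem_range.1 hk) q)]] at h1
  linarith

/-- Negative powers involve inverse products, but the indicator puts an endpoint of the stretch in
the avoiding set. For the operator the stretch runs forward from it, for the transpose backward,
hence the two-sided definition of that set. -/
lemma norm_weightedPerm_zpow_indicator_le (hf : ∀ x, f x = productMap τ x)
    (hw : ∀ x, (∀ q, x (ι q) ≠ c q) →
      Real.log ‖(w x : ℂ)‖ = ∑ q, s q * (Real.log |(x (ι q) : ℝ) - c q| - meanLog (c q)))
    (hs : ∀ q, 0 ≤ s q) (hΔ : ∀ i n, mapDiscrepancy (τ i) n ≤ Δ n) (hδ : 0 < δ) (hδ1 : δ ≤ 1)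
    {x : Fin d → I} (hx : IsGenericPoint f ι c x) (n : ℤ) :
    ‖(weightedPerm f w ^ n) ((avoidingSet f ι c δ).indicator 1) x‖ ≤
        Real.exp ((∑ q, s q) * koksmaError δ (Δ n.natAbs) n.natAbs) ∧
    ‖(weightedPermTranspose f w ^ n) ((avoidingSet f ι c δ).indicator 1) x‖ ≤
        Real.exp ((∑ q, s q) * koksmaError δ (Δ n.natAbs) n.natAbs) := by
  have hx' : ∀ n : ℕ, IsGenericPoint f ι c ((f ^ n)⁻¹ x) := fun n => by
    have := hx.zpow (-n)
    rwa [zpow_neg, zpow_natCast] at this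
  obtain ⟨n, rfl | rfl⟩ := n.eq_nat_or_neg
  · rw [zpow_natCast, zpow_natCast, Int.natAbs_natCast, weightedPerm_pow_apply,
      weightedPermTranspose_pow_apply]
    exact ⟨norm_mul_indicator_one_le (Real.exp_pos _).le fun _ =>
        norm_prod_orbit_le hf hw hs hΔ hδ hδ1 hx n,
      norm_mul_indicator_one_le (Real.exp_pos _).le fun _ =>
        norm_prod_orbit_le hf hw hs hΔ hδ hδ1 (hx' n) n⟩
  · rw [zpow_neg, zpow_neg, zpow_natCast, zpow_natCast, Int.natAbs_neg, Int.natAbs_natCast,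
      weightedPerm_pow_inv_apply, weightedPermTranspose_pow_inv_apply]
    refine ⟨norm_mul_indicator_one_le (Real.exp_pos _).le fun hz =>
        norm_inv_prod_orbit_le hf hw hs hΔ hδ hδ1 (hx' n) fun k hk q => ?_,
      norm_mul_indicator_one_le (Real.exp_pos _).le fun hz =>
        norm_inv_prod_orbit_le hf hw hs hΔ hδ hδ1 hx fun k hk q => ?_⟩
    · rw [← zpow_natCast f k]
      exact far_of_mem_avoidingSet hδ hz (by omega) q
    · have h := far_of_mem_avoidingSet hδ hz (m := (k : ℤ) - n) (n := n) (by omega) q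
      rwa [← zpow_natCast f n, ← Equiv.Perm.mul_apply, ← zpow_add, sub_add_cancel,
        zpow_natCast] at h

end Growth

/-! ### Almost every point is generic; the avoiding set has positive measure -/

section Measure

variable {d : ℕ} {e : (Fin d → I) ≃ᵐ (Fin d → I)} {κ : Type*} {ι : κ → Fin d}
  {c : κ → I}

lemma measurePreserving_zpow {X : Type*} [MeasurableSpace X] {μ : Measure X} {e : X ≃ᵐ X}
    (he : MeasurePreserving e μ μ) (n : ℤ) :
    MeasurePreserving ⇑((e.toEquiv : Equiv.Perm X) ^ n) μ μ := by
  induction n using Int.induction_on with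
  | zero => exact MeasurePreserving.id μ
  | succ n ih =>
    rw [zpow_add_one, Equiv.Perm.coe_mul]
    exact ih.comp he
  | pred n ih =>
    rw [zpow_sub_one, Equiv.Perm.coe_mul]
    exact ih.comp (he.symm e)

variable [Fintype κ]

lemma ae_isGenericPoint (he : MeasurePreserving e volume volume) :
    ∀ᵐ x, IsGenericPoint e.toEquiv ι c x := by
  have h1 : ∀ (k : ℤ) i, ∀ᵐ x : Fin d → I,
      ((((e.toEquiv : Equiv.Perm _) ^ k) x i : I) : ℝ) < 1 := fun k i => by
    filter_upwards [(measurePreserving_zpow he k).quasiMeasurePreserving.ae (ae_apply_ne i 1)]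
      with x hx
    exact lt_of_le_of_ne (Subtype.coe_le_coe.2 unitInterval.le_one') fun h => hx (Subtype.ext h)
  have h2 : ∀ (k : ℤ) q, ∀ᵐ x : Fin d → I, ((e.toEquiv : Equiv.Perm _) ^ k) x (ι q) ≠ c q :=
    fun k q => (measurePreserving_zpow he k).quasiMeasurePreserving.ae (ae_apply_ne (ι q) (c q))
  filter_upwards [ae_all_iff.2 fun k => ae_all_iff.2 (h1 k),
    ae_all_iff.2 fun k => ae_all_iff.2 (h2 k)] with x h1 h2 using ⟨h1, h2⟩

lemma measurableSet_avoidingSet (he : MeasurePreserving e volume volume) (δ : ℝ) :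
    MeasurableSet (avoidingSet e.toEquiv ι c δ) := by
  simp only [avoidingSet, Set.ofPred_forall]
  refine MeasurableSet.iInter fun k => MeasurableSet.iInter fun q => ?_
  have := (measurePreserving_zpow he k).measurable
  exact measurableSet_le measurable_const (by fun_prop)

/-- The complement is covered by preimages of slabs of measure at most `2δ / (|k| + 1) ^ 2`. These
sum to less than 1 for small `δ`, while the logarithm of the threshold costs only `O(log n)`. -/
lemma exists_volume_avoidingSet_ne_zero (he : MeasurePreserving e volume volume) :
    ∃ δ : ℝ, 0 < δ ∧ δ ≤ 1 ∧ volume (avoidingSet e.toEquiv ι c δ) ≠ 0 := by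
  have hsum : Summable fun k : ℤ => 1 / ((k.natAbs : ℝ) + 1) ^ 2 := by
    have h : Summable fun n : ℕ => 1 / ((n : ℝ) + 1) ^ 2 := by
      have := (summable_nat_add_iff 1).2 (Real.summable_one_div_nat_pow.2 one_lt_two)
      exact this.congr fun n => by push_cast; rfl
    exact Summable.of_nat_of_neg (by simpa using h) (by simpa using h)
  set S := ∑' k : ℤ, 1 / ((k.natAbs : ℝ) + 1) ^ 2
  have hS : 0 ≤ S := tsum_nonneg fun k => by positivity
  set M : ℝ := 2 * (Fintype.card κ * (S + 1)) + 1
  have hM : 1 ≤ M := by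
    have : 0 ≤ 2 * (Fintype.card κ * (S + 1)) := by positivity
    linarith
  refine ⟨1 / M, by positivity, div_le_one_of_le₀ hM (by positivity), fun h0 => ?_⟩
  have h1 : volume (avoidingSet e.toEquiv ι c (1 / M))ᶜ ≤
      ENNReal.ofReal (Fintype.card κ * (2 * (1 / M) * S)) := by
    have hsub : (avoidingSet e.toEquiv ι c (1 / M))ᶜ ⊆ ⋃ q : κ, ⋃ k : ℤ,
        ⇑((e.toEquiv : Equiv.Perm (Fin d → I)) ^ k) ⁻¹'
          {x | |(x (ι q) : ℝ) - c q| < 1 / M / (k.natAbs + 1) ^ 2} := by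
      intro x hx
      simp only [avoidingSet, Set.mem_compl_iff, Set.mem_ofPred_eq, not_forall, not_le] at hx
      obtain ⟨k, q, h⟩ := hx
      exact Set.mem_iUnion.2 ⟨q, Set.mem_iUnion.2 ⟨k, h⟩⟩
    refine (measure_mono hsub).trans ((measure_iUnion_fintype_le _ _).trans ?_)
    have : ∀ q ∈ (Finset.univ : Finset κ), volume (⋃ k : ℤ,
        ⇑((e.toEquiv : Equiv.Perm (Fin d → I)) ^ k) ⁻¹'
          {x | |(x (ι q) : ℝ) - c q| < 1 / M / (k.natAbs + 1) ^ 2}) ≤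
        ENNReal.ofReal (2 * (1 / M) * S) := by
      intro q _
      refine (measure_iUnion_le _).trans ?_
      rw [← tsum_mul_left, ENNReal.ofReal_tsum_of_nonneg (fun k => by positivity)
        (hsum.mul_left _)]
      refine ENNReal.tsum_le_tsum fun k => ?_
      rw [(measurePreserving_zpow he k).measure_preimage
        (measurableSet_lt (by fun_prop) (by fun_prop)).nullMeasurableSet]
      refine (volume_slab_le _ _ _).trans (ENNReal.ofReal_le_ofReal (le_of_eq ?_))
      ring
    refine (Finset.sum_le_sum this).trans (le_of_eq ?_)
    rw [Finset.sum_const, Finset.card_univ, nsmul_eq_mul, ENNReal.ofReal_mul (Nat.cast_nonneg _),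
      ENNReal.ofReal_natCast]
  have h2 : volume (avoidingSet e.toEquiv ι c (1 / M))ᶜ = 1 := by
    rw [prob_compl_eq_one_sub (measurableSet_avoidingSet he _), h0, tsub_zero]
  rw [h2, ENNReal.one_le_ofReal] at h1
  have h3 : Fintype.card κ * (2 * (1 / M) * S) = 2 * (Fintype.card κ * S) / M := by ring
  rw [h3, le_div_iff₀ (by positivity)] at h1
  have : (Fintype.card κ : ℝ) * S ≤ Fintype.card κ * (S + 1) := by gcongr; linarith
  simp only [M] at h1
  linarith

end Measure

end WeightedComposition

namespace WeightedComposition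

/-! ### The operator -/

lemma exists_isWeightedCompositionOperator {d : ℕ} {p : ℝ≥0∞} [Fact (1 ≤ p)]
    {V : (Fin d → I) → ℂ} (hV : MemLp V ∞ (volume : Measure (Fin d → I)))
    {τ : (Fin d → I) → (Fin d → I)} (hτ : MeasurePreserving τ volume volume) :
    ∃ T : LpCube d p →L[ℂ] LpCube d p, IsWeightedCompositionOperator V τ T := by
  refine ⟨((ContinuousLinearMap.mul ℂ ℂ).holderL volume ∞ p p (hV.toLp V)).comp
    (Lp.compMeasurePreservingₗᵢ ℂ τ hτ).toContinuousLinearMap, fun f => ?_⟩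
  filter_upwards [(ContinuousLinearMap.mul ℂ ℂ).coeFn_holder (r := p) (hV.toLp V)
    (Lp.compMeasurePreserving τ hτ f), hV.coeFn_toLp, Lp.coeFn_compMeasurePreserving f hτ]
    with x h1 h2 h3
  rw [h2, h3] at h1
  exact h1

/-- The measurable equivalence given by a measurable bijection of the cube. -/
noncomputable def cubeEquiv {d : ℕ} {F : (Fin d → I) → (Fin d → I)} (hF : Measurable F)
    (hbij : Function.Bijective F) : (Fin d → I) ≃ᵐ (Fin d → I) where
  toEquiv := Equiv.ofBijective F hbij
  measurable_toFun := hF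
  measurable_invFun := by
    intro s hs
    -- Lusin–Souslin: an injective measurable map of standard Borel spaces has measurable images.
    have h := (hF.measurableEmbedding hbij.1).measurableSet_image.2 hs
    have h2 := (Equiv.ofBijective F hbij).image_eq_preimage_symm s
    change MeasurableSet ((Equiv.ofBijective F hbij).symm ⁻¹' s)
    rw [← h2]
    exact h

lemma tendsto_zero_of_discrepancyCondition {d : ℕ} {τ : Fin d → I → I} {ε : ℝ} (hε : 0 < ε)
    (hD : DiscrepancyCondition τ ε) (i : Fin d) :
    Tendsto (fun n => mapDiscrepancy (τ i) n) atTop (𝓝 0) := by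
  have h1 : Tendsto (fun n : ℕ => 1 / Real.log (n : ℝ) ^ (3 + ε)) atTop (𝓝 0) := by
    simp only [one_div]
    exact ((tendsto_rpow_atTop (by linarith)).comp
      (Real.tendsto_log_atTop.comp tendsto_natCast_atTop_atTop)).inv_tendsto_atTop
  exact squeeze_zero (fun n => mapDiscrepancy_nonneg _ _) (fun n => mapDiscrepancy_le_iSup τ i n)
    (hD.trans_tendsto h1)

/-- The conclusion of the main theorem for a bijective measure-preserving product map satisfying
the discrepancy condition. -/
theorem exists_operator_of_bijective {d : ℕ} (hd : 0 < d) (p : ℝ≥0∞) [Fact (1 ≤ p)]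
    {v : Fin d → I → ℂ} (hv : ∀ i, IsGeneralizedPolynomial (v i)) {ε : ℝ} (hε : 0 < ε)
    {τ : Fin d → I → I} (hbij : Function.Bijective (productMap τ))
    (hτ : MeasurePreserving (productMap τ) volume volume) (hD : DiscrepancyCondition τ ε) :
    ∃ T : LpCube d p →L[ℂ] LpCube d p,
      IsWeightedCompositionOperator (productWeight v) (productMap τ) T ∧
      HasNontrivialHyperinvariantSubspace T := by
  classical
  have : Nonempty (Fin d) := ⟨⟨0, hd⟩⟩
  obtain ⟨hVm, l, A, c, s, hA, hs, hV⟩ := productWeight_measurable_and_norm_eq hv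
  have hVtop : MemLp (productWeight v) ∞ (volume : Measure (Fin d → I)) := by
    refine memLp_top_of_bound hVm.aestronglyMeasurable A (.of_forall fun x => ?_)
    rw [hV]
    refine mul_le_of_le_one_right hA.le (Finset.prod_le_one
      (fun q _ => Real.rpow_nonneg (abs_nonneg _) _) fun q _ => ?_)
    refine Real.rpow_le_one (abs_nonneg _) ?_ (hs q).le
    have h1 := (x q.1).2
    have h2 := (c q).2
    rw [abs_le]; constructor <;> linarith [h1.1, h1.2, h2.1, h2.2]
  obtain ⟨T, hT⟩ := exists_isWeightedCompositionOperator (p := p) hVtop hτ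
  refine ⟨T, hT, ?_⟩
  set e := cubeEquiv hτ.measurable hbij
  have he : MeasurePreserving e volume volume := hτ
  have hf : ∀ x, (e.toEquiv : Equiv.Perm (Fin d → I)) x = productMap τ x := fun x => rfl
  set ι : (Σ i, Fin (l i + 1)) → Fin d := fun q => q.1
  -- `exp m` is the geometric mean of the absolute value of the weight.
  set m : ℝ := Real.log A + ∑ q, s q * meanLog (c q) with hm
  have hζ : (Real.exp m : ℂ) ≠ 0 := by exact_mod_cast (Real.exp_pos m).ne'
  -- The value 1 on the zeros makes every weight invertible; the zeros form a null set.
  set w : (Fin d → I) → ℂˣ := fun x =>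
    if h : productWeight v x = 0 then 1 else Units.mk0 (productWeight v x / Real.exp m)
      (div_ne_zero h hζ) with hwdef
  have hwval : ∀ x, (w x : ℂ) =
      if productWeight v x = 0 then 1 else productWeight v x / Real.exp m := fun x => by
    simp only [hwdef]; split_ifs <;> rfl
  have hwm : Measurable fun x => (w x : ℂ) := by
    simp only [hwval]
    exact Measurable.ite (hVm (measurableSet_singleton 0)) measurable_const (hVm.div_const _)
  have hVne : ∀ x : Fin d → I, (∀ q, x (ι q) ≠ c q) → ∀ q, 0 < |(x (ι q) : ℝ) - c q| := fun x hx q =>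
    abs_pos.2 (sub_ne_zero.2 fun h => hx q (Subtype.ext h))
  have hV0 : ∀ x : Fin d → I, (∀ q, x (ι q) ≠ c q) → productWeight v x ≠ 0 := fun x hx => by
    rw [← norm_pos_iff, hV]
    exact mul_pos hA (Finset.prod_pos fun q _ => Real.rpow_pos_of_pos (hVne x hx q) _)
  have hwlog : ∀ x : Fin d → I, (∀ q, x (ι q) ≠ c q) → Real.log ‖(w x : ℂ)‖ =
      ∑ q, s q * (Real.log |(x (ι q) : ℝ) - c q| - meanLog (c q)) := by
    intro x hx
    rw [hwval, if_neg (hV0 x hx), norm_div, hV, Complex.norm_real,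
      Real.norm_of_nonneg (Real.exp_pos m).le, Real.log_div _ (Real.exp_pos m).ne', Real.log_exp,
      Real.log_mul hA.ne', Real.log_prod, hm]
    · simp only [mul_sub, Finset.sum_sub_distrib]
      rw [Finset.sum_congr rfl fun q _ => Real.log_rpow (hVne x hx q) (s q)]
      ring
    · exact fun q _ => (Real.rpow_pos_of_pos (hVne x hx q) _).ne'
    · exact (Finset.prod_pos fun q _ => Real.rpow_pos_of_pos (hVne x hx q) _).ne'
    · exact (mul_pos hA (Finset.prod_pos fun q _ => Real.rpow_pos_of_pos (hVne x hx q) _)).ne'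
  have hgen : ∀ᵐ x, IsGenericPoint e.toEquiv ι c x := ae_isGenericPoint he
  obtain ⟨δ, hδ, hδ1, hE0⟩ := exists_volume_avoidingSet_ne_zero (ι := ι) (c := c) he
  set Δ : ℕ → ℝ := fun n => ⨆ i, mapDiscrepancy (τ i) n
  have hΔ : ∀ i n, mapDiscrepancy (τ i) n ≤ Δ n := mapDiscrepancy_le_iSup τ
  have hΔ0 : ∀ n, 0 ≤ Δ n := fun n => (mapDiscrepancy_nonneg _ _).trans (hΔ ⟨0, hd⟩ n)
  have hS : 0 ≤ ∑ q, s q := Finset.sum_nonneg fun q _ => (hs q).le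
  obtain ⟨N, hN, hNB⟩ := exists_dyadic_majorant hδ hδ1 hε hS hΔ0
    (fun n => ciSup_le fun i => mapDiscrepancy_le_one _ _) hD
  refine hasNontrivialHyperinvariantSubspace_of_growth he hwm hζ (fun h => ?_)
    (measurableSet_avoidingSet (ι := ι) (c := c) he δ) hE0 hN
    (R := fun n => Real.exp ((∑ q, s q) * koksmaError δ (Δ n) n)) (fun n => (Real.exp_pos _).le)
    (fun j n h1 h2 => Real.exp_le_exp.2 (hNB j n h1 h2))
    (fun n => hgen.mono fun x hx => (norm_weightedPerm_zpow_indicator_le hf hwlog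
      (fun q => (hs q).le) hΔ hδ hδ1 hx n).1)
    (fun n => hgen.mono fun x hx => (norm_weightedPerm_zpow_indicator_le hf hwlog
      (fun q => (hs q).le) hΔ hδ hδ1 hx n).2)
    (hgen.mono fun x hx n hn => zpow_apply_ne_of_tendsto_mapDiscrepancy hf ⟨0, hd⟩
      (tendsto_zero_of_discrepancyCondition hε hD _) (hx.1 0 _) hn)
  filter_upwards [hT h, hgen] with x h1 h2
  rw [h1, hwval, if_neg (hV0 x fun q => h2.2 0 q), ← mul_assoc, mul_div_cancel₀ _ hζ]
  rfl

/-! ### Rotations -/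

/-- The rotation of `[0, 1)`, extended to a bijection of `[0, 1]` fixing the endpoint `1`. -/
noncomputable def rotationFixingOne (α : ℝ) (x : I) : I := if (x : ℝ) < 1 then rotation α x else x

lemma coe_rotation_lt_one (α : ℝ) (x : I) : (rotation α x : ℝ) < 1 := Int.fract_lt_one _

lemma rotationFixingOne_neg (α : ℝ) (x : I) :
    rotationFixingOne (-α) (rotationFixingOne α x) = x := by
  by_cases hx : (x : ℝ) < 1
  · rw [rotationFixingOne, rotationFixingOne, if_pos hx, if_pos (coe_rotation_lt_one α x)]
    refine Subtype.ext ?_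
    change Int.fract (Int.fract ((x : ℝ) + α) + -α) = x
    rw [Int.fract_eq_iff]
    refine ⟨x.2.1, hx, -⌊(x : ℝ) + α⌋, ?_⟩
    rw [Int.fract]; push_cast; ring
  · simp [rotationFixingOne, hx]

lemma bijective_productMap_rotationFixingOne {d : ℕ} (α : Fin d → ℝ) :
    Function.Bijective (productMap fun i => rotationFixingOne (α i)) := by
  refine Function.bijective_iff_has_inverse.2
    ⟨productMap fun i => rotationFixingOne (-α i), fun x => ?_, fun x => ?_⟩
  · ext1 i; exact rotationFixingOne_neg _ _
  · ext1 i
    have := rotationFixingOne_neg (-α i) (x i)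
    rwa [neg_neg] at this

/-- Starting points are below 1, and their orbits never reach 1, the only point where the maps can
differ. -/
lemma mapDiscrepancy_rotationFixingOne (α : ℝ) :
    mapDiscrepancy (rotationFixingOne α) = mapDiscrepancy (rotation α) := by
  have h : ∀ (x : I), (x : ℝ) < 1 → ∀ n, (rotationFixingOne α)^[n] x = (rotation α)^[n] x ∧
      ((rotation α)^[n] x : ℝ) < 1 := by
    intro x hx n
    induction n with
    | zero => exact ⟨rfl, hx⟩
    | succ n ih =>
      rw [Function.iterate_succ_apply', Function.iterate_succ_apply', ih.1, rotationFixingOne,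
        if_pos ih.2]
      exact ⟨rfl, coe_rotation_lt_one _ _⟩
  ext N
  unfold mapDiscrepancy
  congr 1
  ext r
  refine exists_congr fun x => and_congr_right fun hx => ?_
  simp only [(h x hx _).1]

lemma measurePreserving_coe_unitAddCircle :
    MeasurePreserving (fun x : I => ((x : ℝ) : UnitAddCircle)) volume volume := by
  have h1 : MeasurePreserving (Subtype.val : I → ℝ) volume (volume.restrict (Set.Icc 0 1)) :=
    measurePreserving_subtype_coe measurableSet_Icc
  have h2 := UnitAddCircle.measurePreserving_mk 0
  rw [zero_add, restrict_Ioc_eq_restrict_Icc] at h2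
  exact h2.comp h1

/-- The representative in `[0, 1)` of a point of the circle. -/
noncomputable def circleRepr (y : UnitAddCircle) : I :=
  ⟨(AddCircle.measurableEquivIco 1 0 y : ℝ), (AddCircle.measurableEquivIco 1 0 y).2.1,
    by simpa using (AddCircle.measurableEquivIco 1 0 y).2.2.le⟩

lemma coe_circleRepr_coe (x : ℝ) : (circleRepr (x : UnitAddCircle) : ℝ) = Int.fract x := by
  have h := AddCircle.coe_equivIco_mk_apply (1 : ℝ) x
  rw [div_one, mul_one] at h
  exact h

/-- It is almost everywhere a left inverse of the measure-preserving quotient map from the interval.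
-/
lemma measurePreserving_circleRepr : MeasurePreserving circleRepr volume volume := by
  have hm : Measurable circleRepr :=
    ((measurable_subtype_coe.comp (AddCircle.measurableEquivIco 1 0).measurable)).subtype_mk
  refine ⟨hm, ?_⟩
  rw [← measurePreserving_coe_unitAddCircle.map_eq,
    Measure.map_map hm measurePreserving_coe_unitAddCircle.measurable]
  have hae : (circleRepr ∘ fun x : I => ((x : ℝ) : UnitAddCircle)) =ᵐ[volume] id := by
    have : ∀ᵐ x : I, x ≠ 1 := by simp [ae_iff]
    filter_upwards [this] with x hx
    refine Subtype.ext ?_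
    rw [Function.comp_apply, coe_circleRepr_coe, id, Int.fract_eq_self]
    exact ⟨x.2.1, lt_of_le_of_ne x.2.2 fun h => hx (Subtype.ext h)⟩
  rw [Measure.map_congr hae, Measure.map_id]

lemma measurePreserving_rotation (α : ℝ) : MeasurePreserving (rotation α) volume volume := by
  have h := measurePreserving_circleRepr.comp
    ((measurePreserving_add_right volume (α : UnitAddCircle)).comp
      measurePreserving_coe_unitAddCircle)
  convert h using 1
  ext x
  simp only [Function.comp_apply]
  rw [← AddCircle.coe_add, coe_circleRepr_coe]
  rfl

lemma productMap_rotationFixingOne_ae_eq {d : ℕ} (α : Fin d → ℝ) :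
    productMap (fun i => rotationFixingOne (α i)) =ᵐ[volume] productMap fun i => rotation (α i) := by
  filter_upwards [ae_all_iff.2 fun i => ae_apply_ne i (1 : I)] with x hx
  ext1 i
  have : (x i : ℝ) < 1 := lt_of_le_of_ne (x i).2.2 fun h => hx i (Subtype.ext h)
  simp [productMap, rotationFixingOne, this]

lemma measurePreserving_productMap_rotation {d : ℕ} (α : Fin d → ℝ) :
    MeasurePreserving (productMap fun i => rotation (α i)) volume volume :=
  volume_preserving_pi fun i => measurePreserving_rotation (α i)

lemma measurable_rotationFixingOne (α : ℝ) : Measurable (rotationFixingOne α) :=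
  Measurable.ite (measurableSet_lt (by fun_prop) measurable_const)
    (measurePreserving_rotation α).measurable measurable_id

lemma measurePreserving_productMap_rotationFixingOne {d : ℕ} (α : Fin d → ℝ) :
    MeasurePreserving (productMap fun i => rotationFixingOne (α i)) volume volume := by
  refine ⟨measurable_pi_lambda _ fun i =>
    (measurable_rotationFixingOne (α i)).comp (measurable_pi_apply i), ?_⟩
  rw [Measure.map_congr (productMap_rotationFixingOne_ae_eq α)]
  exact (measurePreserving_productMap_rotation α).map_eq

end WeightedComposition

/-! ### The main theorem -/

theorem mainTheorem7 (d : ℕ) (hd : 0 < d) (p : ℝ≥0∞) [Fact (1 ≤ p)]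
    (v : Fin d → I → ℂ) (hv : ∀ i, WeightedComposition.IsGeneralizedPolynomial (v i))
    (ε : ℝ) (hε : 0 < ε) :
    (∀ τ : Fin d → I → I,
      Function.Bijective (WeightedComposition.productMap τ) →
      Ergodic (WeightedComposition.productMap τ) MeasureTheory.volume →
      WeightedComposition.DiscrepancyCondition τ ε →
      ∃ T : WeightedComposition.LpCube d p →L[ℂ] WeightedComposition.LpCube d p,
        WeightedComposition.IsWeightedCompositionOperator
          (WeightedComposition.productWeight v) (WeightedComposition.productMap τ) T ∧
        WeightedComposition.HasNontrivialHyperinvariantSubspace T) ∧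
    (∀ α : Fin d → ℝ,
      WeightedComposition.IsIrrationalVector α →
      WeightedComposition.DiscrepancyCondition
        (fun i => WeightedComposition.rotation (α i)) ε →
      ∃ T : WeightedComposition.LpCube d p →L[ℂ] WeightedComposition.LpCube d p,
        WeightedComposition.IsWeightedCompositionOperator
          (WeightedComposition.productWeight v)
          (WeightedComposition.productMap fun i => WeightedComposition.rotation (α i)) T ∧
        WeightedComposition.HasNontrivialHyperinvariantSubspace T) := by
  refine ⟨fun τ hbij herg hD => WeightedComposition.exists_operator_of_bijective hd p hv hε hbij
    herg.toMeasurePreserving hD, fun α _ hD => ?_⟩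
  -- A rotation sends 0 and 1 to the same point, so it is not injective on `[0,1]`. Fixing the
  -- endpoint restores bijectivity and changes the map only on a null set, so the operator is the
  -- same.
  have hae := WeightedComposition.productMap_rotationFixingOne_ae_eq α
  obtain ⟨T, hT, hhyp⟩ := WeightedComposition.exists_operator_of_bijective hd p hv hε
    (WeightedComposition.bijective_productMap_rotationFixingOne α)
    (WeightedComposition.measurePreserving_productMap_rotationFixingOne α) (by
      simpa only [WeightedComposition.DiscrepancyCondition,
        WeightedComposition.mapDiscrepancy_rotationFixingOne] using hD)
  refine ⟨T, fun f => ?_, hhyp⟩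
  filter_upwards [hT f, hae] with x h1 h2
  rw [h1, h2]
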